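/- **Conventions.** A *probability algebra* is a pair $X=(\mathcal B_X,\mu_X)$ of a $\sigma$-complete Boolean algebra and a countably additive $\mu_X:\mathcal B_X\to[0,1]$ with $\mu_X(1)=1$ and $\mu_X(E)>0$ for $E\neq 0$. A morphism $T:X\to Y$ is a Boolean homomorphism $T^*:\mathcal B_Y\to\mathcal B_X$ with $\mu_X\circ T^*=\mu_Y$, and $(S\circ T)^*=T^*\circ S^*$. For a group $\Gamma$, a *$\mathbf{ProbAlg}_\Gamma$-system* is a probability algebra $X$ with a homomorphism $\gamma\mapsto T_X^\gamma$ from $\Gamma$ to its automorphism group; a factor map is a morphism that commutes with the actions; $X$ is *ergodic* if $0,1$ are the only $E\in\mathcal B_X$ with $(T_X^\gamma)^*E=E$ for all $\gamma\in\Gamma$. For a compact Hausdorff space $Z$ with Baire $\sigma$-algebra $\mathrm{Ba}(Z)$ (generated by the continuous functions $Z\to\mathbb C$), $\mathrm{Cond}_X(Z)$ is the set of Boolean homomorphisms $\theta^*:\mathrm{Ba}(Z)\to\mathcal B_X$ that preserve countable joins and meets, regarded as maps $\theta:X\to Z$ and composed accordingly with morphisms into $X$ and continuous maps out of $Z$.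 Let $\mathrm{Stone}(X)$ be the Stone space of ultrafilters of $\mathcal B_X$. Every $\theta\in\mathrm{Cond}_X(Z)$ has a canonical representation $\tilde\theta\in C(\mathrm{Stone}(X),Z)$, where $\tilde\theta(s)$ is the unique $z\in Z$ such that $\theta^*E\in s$ for every Baire neighbourhood $E$ of $z$; the map $\theta\mapsto\tilde\theta$ is a bijection $\mathrm{Cond}_X(Z)\to C(\mathrm{Stone}(X),Z)$. For a compact Hausdorff group $K$ and a closed subgroup $L$, pointwise operations on canonical representations make $\mathrm{Cond}_X(K)$ a group acting on $\mathrm{Cond}_X(K/L)$, where $K/L$ is the space of left cosets. Let $Y$ be a $\mathbf{ProbAlg}_\Gamma$-system. A *$\mathbf{ProbAlg}_\Gamma$-homogeneous extension* of $Y$ by $K/L$ is a tuple $(X,\pi,\theta,\rho)$ of a $\mathbf{ProbAlg}_\Gamma$-system $X$, a factor map $\pi:X\to Y$, a *vertical coordinate* $\theta\in\mathrm{Cond}_X(K/L)$ such that the ranges of $\pi^*$ and $\theta^*$ together generate $\mathcal B_X$ as a $\sigma$-complete Boolean algebra, and a family $\rho=(\rho_\gamma)_{\gamma\in\Gamma}$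 in $\mathrm{Cond}_Y(K)$ with $$\rho_{\gamma\gamma'}=(\rho_\gamma\circ T_Y^{\gamma'})\,\rho_{\gamma'},\qquad \theta\circ T_X^\gamma=(\rho_\gamma\circ\pi)\,\theta\qquad(\gamma,\gamma'\in\Gamma).$$ A *$\mathbf{ProbAlg}_\Gamma$-group extension* of $Y$ by $K$ is the case of trivial $L$, with $K/\{1\}=K$. **Theorem 6.1.** Let $\Gamma$ be a group, $Y$ an ergodic $\mathbf{ProbAlg}_\Gamma$-system, $K$ a compact Hausdorff group, $L$ a closed subgroup of $K$, and $(X,\pi_{X\to Y},\theta,\rho)$ a $\mathbf{ProbAlg}_\Gamma$-homogeneous extension of $Y$ by $K/L$ with $X$ ergodic. (i) There exist a $\mathbf{ProbAlg}_\Gamma$-group extension $(X',\pi_{X'\to Y},\theta',\rho')$ of $Y$ by $K$ and a factor map $\pi_{X'\to X}:X'\to X$ such that $$\pi_{X'\to Y}=\pi_{X\to Y}\circ\pi_{X'\to X}\qquad\text{and}\qquad \pi_{K/L}\circ\theta'=\theta\circ\pi_{X'\to X},$$ where $\pi_{K/L}:K\to K/L$ is the canonical projection. (ii) In (i), the system $X'$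 can be chosen to be ergodic. -/

import Mathlib

universe uX uY uZ uW uG uK

namespace AbstractErgodic

/-- A probability algebra: a σ-complete Boolean algebra with a countably additive probability
measure that is strictly positive on non-zero elements. -/
structure ProbAlg where
  carrier : Type uX
  [boolAlg : BooleanAlgebra carrier]
  sigmaComplete : ∀ f : ℕ → carrier, ∃ a, IsLUB (Set.range f) a
  μ : carrier → ℝ
  μ_nonneg : ∀ a, 0 ≤ μ a
  μ_top : μ ⊤ = 1
  μ_sigma : ∀ f : ℕ → carrier, Pairwise (fun m n => Disjoint (f m) (f n)) →
    ∀ a, IsLUB (Set.range f) a → HasSum (fun n => μ (f n)) (μ a)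
  μ_pos : ∀ a, a ≠ ⊥ → 0 < μ a

instance : CoeSort ProbAlg.{uX} (Type uX) := ⟨ProbAlg.carrier⟩

instance (X : ProbAlg.{uX}) : BooleanAlgebra X := X.boolAlg

/-- A morphism `X → Y` of probability algebras: a measure-preserving Boolean homomorphism in the
opposite direction, the pullback map. -/
@[ext]
structure ProbAlg.Hom (X : ProbAlg.{uX}) (Y : ProbAlg.{uY}) where
  pullback : BoundedLatticeHom Y X
  μ_pullback : ∀ a : Y, X.μ (pullback a) = Y.μ a

def ProbAlg.Hom.id (X : ProbAlg.{uX}) : ProbAlg.Hom X X where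
  pullback := BoundedLatticeHom.id X
  μ_pullback _ := rfl

/-- The composition `S ∘ T`. -/
def ProbAlg.Hom.comp {X : ProbAlg.{uX}} {Y : ProbAlg.{uY}} {Z : ProbAlg.{uZ}}
    (S : ProbAlg.Hom Y Z) (T : ProbAlg.Hom X Y) : ProbAlg.Hom X Z where
  pullback := T.pullback.comp S.pullback
  μ_pullback a := (T.μ_pullback _).trans (S.μ_pullback a)

/-! ### Measure-preserving Boolean homomorphisms preserve countable joins -/

theorem ProbAlg.μ_bot (X : ProbAlg.{uX}) : X.μ ⊥ = 0 := by
  have h := X.μ_sigma (fun _ => ⊥) (fun _ _ _ => disjoint_bot_left) ⊥ (by simp)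
  have := h.summable.tendsto_atTop_zero
  exact tendsto_nhds_unique tendsto_const_nhds this

theorem ProbAlg.μ_sup (X : ProbAlg.{uX}) {a b : X} (h : Disjoint a b) :
    X.μ (a ⊔ b) = X.μ a + X.μ b := by
  let f : ℕ → X := fun n => if n = 0 then a else if n = 1 then b else ⊥
  have hd : Pairwise (fun m n => Disjoint (f m) (f n)) := by
    intro m n hmn
    rcases m with _ | _ | m <;> rcases n with _ | _ | n <;> simp_all [f, h.symm]
  have hl : IsLUB (Set.range f) (a ⊔ b) := by
    constructor
    · rintro _ ⟨n, rfl⟩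
      rcases n with _ | _ | n <;> simp [f]
    · intro c hc
      exact sup_le (hc ⟨0, by simp [f]⟩) (hc ⟨1, by simp [f]⟩)
  have h1 := X.μ_sigma f hd _ hl
  have h2 : HasSum (fun n => X.μ (f n)) (∑ n ∈ Finset.range 2, X.μ (f n)) := by
    apply hasSum_sum_of_ne_finset_zero
    intro n hn
    have : 1 < n := by simpa using hn
    have h0 : n ≠ 0 := by omega
    have h1 : n ≠ 1 := by omega
    simp [f, h0, h1, X.μ_bot]
  rw [h1.unique h2]
  simp [Finset.sum_range_succ, f]

theorem ProbAlg.μ_mono (X : ProbAlg.{uX}) {a b : X} (h : a ≤ b) : X.μ a ≤ X.μ b := by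
  have : b = a ⊔ b \ a := by rw [sup_sdiff_cancel_right h]
  rw [this, X.μ_sup disjoint_sdiff_self_right]
  linarith [X.μ_nonneg (b \ a)]

theorem ProbAlg.tendsto_μ_partialSups (X : ProbAlg.{uX}) (f : ℕ → X) (a : X)
    (h : IsLUB (Set.range f) a) :
    Filter.Tendsto (fun n => X.μ (partialSups f n)) Filter.atTop (nhds (X.μ a)) := by
  have hd : Pairwise (fun m n => Disjoint (disjointed f m) (disjointed f n)) :=
    disjoint_disjointed f
  have hl : IsLUB (Set.range (disjointed f)) a := by
    have hu : upperBounds (Set.range (disjointed f)) = upperBounds (Set.range f) := by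
      rw [← upperBounds_range_partialSups (disjointed f), partialSups_disjointed,
        upperBounds_range_partialSups]
    rw [IsLUB, hu]
    exact h
  have hs := ((X.μ_sigma _ hd a hl).tendsto_sum_nat).comp (Filter.tendsto_add_atTop_nat 1)
  refine hs.congr fun n => ?_
  simp only [Function.comp_apply]
  rw [← partialSups_disjointed]
  induction n with
  | zero => simp
  | succ n ih =>
    rw [Finset.sum_range_succ, ih, partialSups_add_one, X.μ_sup]
    rw [partialSups_disjointed, disjointed_add_one]
    exact disjoint_sdiff_self_right

theorem ProbAlg.Hom.pullback_isLUB {X : ProbAlg.{uX}} {Y : ProbAlg.{uY}} (T : ProbAlg.Hom X Y)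
    (f : ℕ → Y) (a : Y) (h : IsLUB (Set.range f) a) :
    IsLUB (Set.range fun n => T.pullback (f n)) (T.pullback a) := by
  constructor
  · rintro _ ⟨n, rfl⟩
    exact OrderHomClass.mono T.pullback (h.1 ⟨n, rfl⟩)
  · intro b hb
    have hps : ∀ n, T.pullback (partialSups f n) ≤ b := by
      intro n
      induction n with
      | zero => simpa using hb ⟨0, rfl⟩
      | succ n ih =>
        rw [partialSups_add_one, map_sup]
        exact sup_le ih (hb ⟨n + 1, rfl⟩)
    have hle : ∀ n, X.μ (T.pullback a \ b) + Y.μ (partialSups f n) ≤ Y.μ a := by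
      intro n
      rw [← T.μ_pullback, ← T.μ_pullback,
        ← X.μ_sup (disjoint_sdiff_self_left.mono_right (hps n))]
      refine X.μ_mono (sup_le sdiff_le (OrderHomClass.mono T.pullback ?_))
      exact partialSups_le f n a fun i _ => h.1 ⟨i, rfl⟩
    have hlim := le_of_tendsto' ((Y.tendsto_μ_partialSups f a h).const_add
      (X.μ (T.pullback a \ b))) hle
    have h0 : T.pullback a \ b = ⊥ := by
      by_contra hne
      linarith [X.μ_pos _ hne]
    exact sdiff_eq_bot_iff.mp h0

/-! ### Systems -/

/-- A probability algebra with an action of the group `Γ`. Since `T 1` is the identity, every `T γ`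
is an automorphism, with inverse `T γ⁻¹`. -/
structure System (Γ : Type uG) [Group Γ] where
  alg : ProbAlg.{uX}
  T : Γ → ProbAlg.Hom alg alg
  T_one : T 1 = ProbAlg.Hom.id alg
  T_mul : ∀ γ γ', T (γ * γ') = (T γ).comp (T γ')

/-- Every invariant element is `⊥` or `⊤`. -/
def System.Ergodic {Γ : Type uG} [Group Γ] (X : System.{uX} Γ) : Prop :=
  ∀ a : X.alg, (∀ γ, (X.T γ).pullback a = a) → a = ⊥ ∨ a = ⊤

/-- A factor map of systems. -/
structure System.Hom {Γ : Type uG} [Group Γ] (X : System.{uX} Γ) (Y : System.{uY} Γ) where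
  toHom : ProbAlg.Hom X.alg Y.alg
  equivariant : ∀ γ, toHom.comp (X.T γ) = (Y.T γ).comp toHom

/-! ### Conditional elements -/

/-- The Baire σ-algebra: the one generated by the continuous complex-valued functions. -/
@[reducible]
noncomputable def baire (Z : Type uZ) [TopologicalSpace Z] : MeasurableSpace Z :=
  ⨆ f : C(Z, ℂ), MeasurableSpace.comap f (borel ℂ)

/-- The Boolean algebra of Baire sets, with the set operations. -/
def BaireSet (Z : Type uZ) [TopologicalSpace Z] : Type uZ :=
  {E : Set Z // @MeasurableSet Z (baire Z) E}

noncomputable instance (Z : Type uZ) [TopologicalSpace Z] : BooleanAlgebra (BaireSet Z) :=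
  @MeasurableSet.Subtype.instBooleanAlgebra Z (baire Z)

def BaireSet.iUnion {Z : Type uZ} [TopologicalSpace Z] (E : ℕ → BaireSet Z) : BaireSet Z :=
  ⟨⋃ n, (E n).1, @MeasurableSet.iUnion Z ℕ (baire Z) _ _ fun n => (E n).2⟩

theorem measurable_baire_of_continuous {Z : Type uZ} {W : Type uW} [TopologicalSpace Z]
    [TopologicalSpace W] (g : C(Z, W)) : @Measurable Z W (baire Z) (baire W) g := by
  rw [measurable_iff_comap_le, baire, MeasurableSpace.comap_iSup]
  refine iSup_le fun f => ?_
  rw [MeasurableSpace.comap_comp]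
  exact le_iSup (fun f : C(Z, ℂ) => MeasurableSpace.comap f (borel ℂ)) (f.comp g)

noncomputable def BaireSet.preimage {Z : Type uZ} {W : Type uW} [TopologicalSpace Z] [TopologicalSpace W]
    (g : C(Z, W)) : BoundedLatticeHom (BaireSet W) (BaireSet Z) where
  toFun E := ⟨g ⁻¹' E.1, measurable_baire_of_continuous g E.2⟩
  map_sup' _ _ := rfl
  map_inf' _ _ := rfl
  map_top' := rfl
  map_bot' := rfl

/-- A conditional element of `Z` over `X`, that is an abstract measurable map from `X` to `Z`: a
Boolean homomorphism from the Baire sets of `Z` to `X` preserving countable joins (hence also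
complements and countable meets). -/
@[ext]
structure Cond (X : ProbAlg.{uX}) (Z : Type uZ) [TopologicalSpace Z] where
  pullback : BoundedLatticeHom (BaireSet Z) X
  isLUB_pullback : ∀ E : ℕ → BaireSet Z,
    IsLUB (Set.range fun n => pullback (E n)) (pullback (BaireSet.iUnion E))

/-- The composition `a ∘ T` of a conditional element with a morphism. -/
noncomputable def Cond.comp {X : ProbAlg.{uX}} {Y : ProbAlg.{uY}} {Z : Type uZ} [TopologicalSpace Z]
    (a : Cond Y Z) (T : ProbAlg.Hom X Y) : Cond X Z where
  pullback := T.pullback.comp a.pullback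
  isLUB_pullback E := T.pullback_isLUB _ _ (a.isLUB_pullback E)

/-- The composition `g ∘ a` of a continuous map with a conditional element. -/
noncomputable def Cond.map {X : ProbAlg.{uX}} {Z : Type uZ} {W : Type uW} [TopologicalSpace Z]
    [TopologicalSpace W] (g : C(Z, W)) (a : Cond X Z) : Cond X W where
  pullback := a.pullback.comp (BaireSet.preimage g)
  isLUB_pullback E := by
    have h := a.isLUB_pullback fun n => BaireSet.preimage g (E n)
    have he : BaireSet.iUnion (fun n => BaireSet.preimage g (E n)) =
        BaireSet.preimage g (BaireSet.iUnion E) := Subtype.ext Set.preimage_iUnion.symm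
    rw [he] at h
    exact h

/-! ### The canonical model and canonical representations -/

/-- The canonical model of `X`: its Stone space, whose points are the ultrafilters of `X`, written
as Boolean homomorphisms to `{false, true}`, with the topology of pointwise convergence. -/
def Stone (X : ProbAlg.{uX}) : Type uX := BoundedLatticeHom X Bool

instance (X : ProbAlg.{uX}) : FunLike (Stone X) X Bool :=
  inferInstanceAs (FunLike (BoundedLatticeHom X Bool) X Bool)

instance (X : ProbAlg.{uX}) : BoundedLatticeHomClass (Stone X) X Bool :=
  inferInstanceAs (BoundedLatticeHomClass (BoundedLatticeHom X Bool) X Bool)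

instance (X : ProbAlg.{uX}) : TopologicalSpace (Stone X) :=
  TopologicalSpace.induced (fun (s : Stone X) (a : X) => s a) inferInstance

theorem Cond.exists_rep {X : ProbAlg.{uX}} {Z : Type uZ} [TopologicalSpace Z] [CompactSpace Z]
    (a : Cond X Z) (s : Stone X) :
    ∃ z : Z, ∀ E : BaireSet Z, E.1 ∈ nhds z → s (a.pullback E) = true := by
  by_contra! hcon
  choose E hE hs using hcon
  obtain ⟨t, ht⟩ := CompactSpace.elim_nhds_subcover (fun z => (E z).1) hE
  have key : ∀ t : Finset Z, s (a.pullback (t.sup E)) = false := by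
    intro t
    induction t using Finset.cons_induction with
    | empty => simp
    | cons z t hz ih => rw [Finset.sup_cons, map_sup, map_sup, ih]; simpa using hs z
  have hsup : ∀ t : Finset Z, (t.sup E).1 = ⋃ z ∈ t, (E z).1 := by
    intro t
    induction t using Finset.cons_induction with
    | empty => simp; rfl
    | cons z t hz ih =>
      rw [Finset.sup_cons]
      refine (congrArg ((E z).1 ∪ ·) ih).trans ?_
      ext x
      simp
  have htop : t.sup E = ⊤ := Subtype.ext ((hsup t).trans ht)
  have := key t
  rw [htop] at this
  simp at this

/-- The canonical representation of a conditional element `a` of a compact Hausdorff space `Z`, a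
continuous map from the canonical model to `Z`: the ultrafilter `s` is sent to the limit in `Z` of
the Baire sets `E` with `a.pullback E` in `s`. -/
noncomputable def Cond.rep {X : ProbAlg.{uX}} {Z : Type uZ} [TopologicalSpace Z] [CompactSpace Z]
    (a : Cond X Z) (s : Stone X) : Z :=
  Classical.choose (a.exists_rep s)

theorem Cond.rep_spec {X : ProbAlg.{uX}} {Z : Type uZ} [TopologicalSpace Z] [CompactSpace Z]
    (a : Cond X Z) (s : Stone X) (E : BaireSet Z) (hE : E.1 ∈ nhds (a.rep s)) :
    s (a.pullback E) = true :=
  Classical.choose_spec (a.exists_rep s) E hE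

theorem BaireSet.exists_separating {Z : Type uZ} [TopologicalSpace Z] [CompactSpace Z] [T2Space Z]
    (z : Z) (U : Set Z) (hU : U ∈ nhds z) : ∃ E F : BaireSet Z,
      E.1 ∈ nhds z ∧ F.1 ⊆ U ∧ IsClosed F.1 ∧ E ≤ F := by
  obtain ⟨f, hf0, hf1, -⟩ := exists_continuous_zero_one_of_isClosed
    (isClosed_singleton (x := z)) (isOpen_interior (s := U)).isClosed_compl
    (by simpa [Set.disjoint_singleton_left] using mem_interior_iff_mem_nhds.mpr hU)
  let g : C(Z, ℂ) := ⟨fun x => (f x : ℂ), by fun_prop⟩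
  have hm : ∀ V : Set ℂ, @MeasurableSet ℂ (borel ℂ) V → @MeasurableSet Z (baire Z) (g ⁻¹' V) :=
    fun V hV => le_iSup (fun f : C(Z, ℂ) => MeasurableSpace.comap f (borel ℂ)) g _ ⟨V, hV, rfl⟩
  have hb : ∀ V : Set ℂ, IsOpen V → @MeasurableSet ℂ (borel ℂ) V :=
    fun V hV => MeasurableSpace.measurableSet_generateFrom hV
  refine ⟨⟨_, hm _ (hb _ (Metric.isOpen_ball (x := (0 : ℂ)) (ε := 1 / 2)))⟩,
    ⟨_, hm (Metric.closedBall 0 (1 / 2)) ?_⟩, ?_, ?_, ?_, ?_⟩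
  · rw [← compl_compl (Metric.closedBall (0 : ℂ) (1 / 2))]
    exact @MeasurableSet.compl ℂ _ (borel ℂ) (hb _ Metric.isClosed_closedBall.isOpen_compl)
  · refine g.continuous.continuousAt.preimage_mem_nhds (Metric.isOpen_ball.mem_nhds ?_)
    have : g z = 0 := by simpa [g] using hf0 rfl
    rw [this]
    simp
  · intro x hx
    by_contra hxU
    have h1 : f x = 1 := hf1 fun h => hxU (interior_subset h)
    have : g x = 1 := by simp [g, h1]
    simp only [Set.mem_preimage, this] at hx
    norm_num at hx
  · exact Metric.isClosed_closedBall.preimage g.continuous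
  · exact Set.preimage_mono Metric.ball_subset_closedBall

theorem Cond.rep_mem {X : ProbAlg.{uX}} {Z : Type uZ} [TopologicalSpace Z] [CompactSpace Z]
    [T2Space Z] (a : Cond X Z) (s : Stone X) (F : BaireSet Z) (hF : IsClosed F.1)
    (hs : s (a.pullback F) = true) : a.rep s ∈ F.1 := by
  by_contra h
  obtain ⟨E, G, hE, hG, -, hle⟩ :=
    BaireSet.exists_separating (a.rep s) (F.1ᶜ) (hF.isOpen_compl.mem_nhds h)
  have h1 := a.rep_spec s E hE
  have hbot : E ⊓ F = ⊥ := by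
    rw [← disjoint_iff]
    refine Disjoint.mono_left hle ?_
    rw [disjoint_iff]
    exact Subtype.ext (Set.disjoint_iff_inter_eq_empty.mp
      (Set.subset_compl_iff_disjoint_right.mp hG))
  have : s (a.pullback (E ⊓ F)) = true := by rw [map_inf, map_inf, h1, hs]; rfl
  rw [hbot] at this
  simp at this

theorem Cond.continuous_rep {X : ProbAlg.{uX}} {Z : Type uZ} [TopologicalSpace Z] [CompactSpace Z]
    [T2Space Z] (a : Cond X Z) : Continuous a.rep := by
  rw [continuous_iff_continuousAt]
  intro s U hU
  obtain ⟨E, F, hE, hF, hFc, hle⟩ := BaireSet.exists_separating (a.rep s) U hU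
  have ho : IsOpen {t : Stone X | t (a.pullback E) = true} := by
    have hc : Continuous fun t : Stone X => t (a.pullback E) :=
      (continuous_apply (a.pullback E)).comp continuous_induced_dom
    exact (isOpen_discrete {true}).preimage hc
  refine Filter.mem_map.mpr (Filter.mem_of_superset (ho.mem_nhds (a.rep_spec s E hE))
    fun t ht => hF ?_)
  refine a.rep_mem t F hFc ?_
  have := OrderHomClass.mono t (OrderHomClass.mono a.pullback hle)
  rw [show t (a.pullback E) = true from ht] at this
  exact top_le_iff.mp this

/-- Relation `c = a • b` between conditional elements `a` of `K` and `b`, `c` of `Z`, with the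
operation obtained from the action of `K` on `Z` through canonical representations: conditional
elements correspond bijectively to continuous maps on the canonical model, where the operation is
pointwise. With `Z = K` this is the relation `c = a * b` of the group of conditional elements. -/
def Cond.IsSMul {X : ProbAlg.{uX}} {K : Type uK} {Z : Type uZ} [TopologicalSpace K]
    [CompactSpace K] [TopologicalSpace Z] [CompactSpace Z] [SMul K Z]
    (c : Cond X Z) (a : Cond X K) (b : Cond X Z) : Prop :=
  ∀ s : Stone X, c.rep s = a.rep s • b.rep s

/-! ### Extensions -/

/-- A `K`-valued cocycle on `Y`: `ρ (γ * γ') = (ρ γ ∘ T γ') * ρ γ'`. -/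
def IsCocycle {Γ : Type uG} [Group Γ] (Y : System.{uY} Γ) (K : Type uK) [Group K]
    [TopologicalSpace K] [CompactSpace K] (ρ : Γ → Cond Y.alg K) : Prop :=
  ∀ γ γ', (ρ (γ * γ')).IsSMul ((ρ γ).comp (Y.T γ')) (ρ γ')

/-- The only σ-complete Boolean subalgebra containing `G` is the whole algebra. -/
def SigmaGenerates (X : ProbAlg.{uX}) (G : Set X) : Prop :=
  ∀ S : Set X, G ⊆ S → ⊥ ∈ S → (∀ a ∈ S, aᶜ ∈ S) →
    (∀ f : ℕ → X, (∀ n, f n ∈ S) → ∀ a, IsLUB (Set.range f) a → a ∈ S) → ∀ a, a ∈ S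

/-- Extensions of `Y` whose vertical coordinate takes values in a space `Z` with an action of `K`;
used only for `Z = K ⧸ L` and `Z = K`. -/
structure Extension {Γ : Type uG} [Group Γ] (Y : System.{uY} Γ) (K : Type uK) [Group K]
    [TopologicalSpace K] [CompactSpace K] (Z : Type uZ) [TopologicalSpace Z] [CompactSpace Z]
    [MulAction K Z] where
  sys : System.{uX} Γ
  π : System.Hom sys Y
  θ : Cond sys.alg Z
  generates : SigmaGenerates sys.alg (Set.range π.toHom.pullback ∪ Set.range θ.pullback)
  ρ : Γ → Cond Y.alg K
  cocycle : IsCocycle Y K ρ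
  equivariant : ∀ γ, (θ.comp (sys.T γ)).IsSMul ((ρ γ).comp π.toHom) θ

/-- Homogeneous extensions of `Y` by `K ⧸ L`, the space of left cosets. -/
abbrev HomogeneousExtension {Γ : Type uG} [Group Γ] (Y : System.{uY} Γ) (K : Type uK) [Group K]
    [TopologicalSpace K] [IsTopologicalGroup K] [CompactSpace K] (L : Subgroup K) :=
  Extension.{uX} Y K (K ⧸ L)

/-- Group extensions of `Y` by `K`: the case of the trivial subgroup, with `K` for the space of
cosets, on which `K` acts by left multiplication. -/
abbrev CompactGroupExtension {Γ : Type uG} [Group Γ] (Y : System.{uY} Γ) (K : Type uK) [Group K]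
    [TopologicalSpace K] [IsTopologicalGroup K] [CompactSpace K] :=
  Extension.{uX} Y K K

/-- The projection `K → K ⧸ L`. -/
def projQuotient (K : Type uK) [Group K] [TopologicalSpace K] (L : Subgroup K) : C(K, K ⧸ L) :=
  ⟨QuotientGroup.mk, QuotientGroup.continuous_mk⟩

end AbstractErgodic

open AbstractErgodic

/-!
The group extension is a measure algebra on the fibre product `W` of the pairs `(s, k)` in
`Stone X × K` for which the vertical coordinate at the ultrafilter `s` is the coset of `k`.
Canonical representations are genuine functions, so the cocycle identity holds at every point of the
Stone space and `Γ` acts on the compact Hausdorff space `W` by homeomorphisms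
`(s, k) ↦ (T s, ρ(π s) * k)`, with the cocycle `ρ` of the given extension
(`FibreProduct.act`).

Consider the invariant probability measures on `W` whose marginal on `Stone X` is the measure of
`X`, as positive linear functionals on `C(W, ℝ)` (`IsInvariantLift`). They form a compact convex
set. It is nonempty: the fibres of `W → Stone X` are the orbits of the compact group `L` acting by
right translation, and one can average over them with the Haar measure of `L`
(`exists_isInvariantLift`). By the Krein-Milman theorem there is an extreme point, and it is ergodic
(`exists_ergodic_measure`). Indeed the normalized restriction of an invariant lift to an invariant
set is invariant, and its marginal is dominated by a multiple of the measure of `X`, hence equal to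
that measure, as `X` is ergodic. This last fact (`System.Ergodic.eq_μ`) is proved inside the
probability algebra, by a Hahn decomposition: the greatest positive element of an invariant set
function is invariant. So an invariant set of intermediate measure would write the extreme point as
a proper convex combination.

The measure algebra of such a measure maps to `X` by `a ↦ {(s, k) | a ∈ s}`, and its vertical
coordinate is the second projection. It is generated by the two, because the functions on `W` that
come from clopen sets of `Stone X` and from `C(K, ℝ)` separate points (`mem_of_separates`), and `X`
itself is generated by `Y` and by the composition of the vertical coordinate with `K → K ⧸ L`.
Identities between conditional elements are verified on Baire sets
(`Cond.isSMul_of_inf_eq_bot`, `Cond.ext_of_closed_le_open`), where they become inclusions of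
subsets of `W`.
-/

namespace AbstractErgodic

/-! ### Stone spaces and conditional elements -/

/-- The set of ultrafilters that contain `a`, a clopen subset of the Stone space. -/
def ProbAlg.basicClopen (X : ProbAlg.{uX}) (a : X) : Set (Stone X) := {s | s a = true}

@[simp]
theorem ProbAlg.mem_basicClopen {X : ProbAlg.{uX}} {a : X} {s : Stone X} :
    s ∈ X.basicClopen a ↔ s a = true := Iff.rfl

/-- The pushforward of ultrafilters along a morphism. -/
noncomputable def Stone.map {X : ProbAlg.{uX}} {Y : ProbAlg.{uY}} (T : ProbAlg.Hom X Y)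
    (s : Stone X) : Stone Y :=
  BoundedLatticeHom.comp s T.pullback

@[simp]
theorem Stone.map_apply {X : ProbAlg.{uX}} {Y : ProbAlg.{uY}} (T : ProbAlg.Hom X Y) (s : Stone X)
    (a : Y) : Stone.map T s a = s (T.pullback a) := rfl

theorem Stone.continuous_eval {X : ProbAlg.{uX}} (a : X) : Continuous fun s : Stone X => s a :=
  (continuous_apply a).comp continuous_induced_dom

theorem Stone.continuous_map {X : ProbAlg.{uX}} {Y : ProbAlg.{uY}} (T : ProbAlg.Hom X Y) :
    Continuous (Stone.map T) :=
  continuous_induced_rng.mpr (continuous_pi fun a => Stone.continuous_eval (T.pullback a))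

theorem ProbAlg.isClopen_basicClopen (X : ProbAlg.{uX}) (a : X) : IsClopen (X.basicClopen a) :=
  (isClopen_discrete {true}).preimage (Stone.continuous_eval a)

theorem Stone.ext_iff {X : ProbAlg.{uX}} {s t : Stone X} : s = t ↔ ∀ a, s a = t a :=
  DFunLike.ext_iff (F := BoundedLatticeHom X Bool)

theorem Stone.isEmbedding {X : ProbAlg.{uX}} :
    Topology.IsEmbedding fun (s : Stone X) (a : X) => s a :=
  ⟨⟨rfl⟩, fun _ _ h => Stone.ext_iff.mpr (congrFun h)⟩

instance {X : ProbAlg.{uX}} : T2Space (Stone X) := Stone.isEmbedding.t2Space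

instance {X : ProbAlg.{uX}} : CompactSpace (Stone X) := by
  -- The Stone space is closed in the product of copies of `Bool`.
  have hr : Set.range (fun (s : Stone X) (a : X) => s a) =
      {x : X → Bool | (∀ a b, x (a ⊔ b) = (x a || x b)) ∧ (∀ a b, x (a ⊓ b) = (x a && x b)) ∧
        x ⊤ = true ∧ x ⊥ = false} := by
    ext x
    constructor
    · rintro ⟨s, rfl⟩
      exact ⟨fun a b => map_sup s a b, fun a b => map_inf s a b, map_top s, map_bot s⟩
    · rintro ⟨h1, h2, h3, h4⟩
      exact ⟨(⟨⟨⟨x, h1⟩, h2⟩, h3, h4⟩ : BoundedLatticeHom X Bool), rfl⟩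
  have hc : IsClosed (Set.range (fun (s : Stone X) (a : X) => s a)) := by
    have hor : Continuous fun p : Bool × Bool => (p.1 || p.2) := continuous_of_discreteTopology
    have hand : Continuous fun p : Bool × Bool => (p.1 && p.2) := continuous_of_discreteTopology
    rw [hr]
    refine IsClosed.and ?_ (IsClosed.and ?_ (IsClosed.and ?_ ?_))
    · simp only [Set.ofPred_forall]
      exact isClosed_iInter fun a => isClosed_iInter fun b => isClosed_eq (by fun_prop)
        (show Continuous ((fun p : Bool × Bool => (p.1 || p.2)) ∘
          fun x : X → Bool => (x a, x b)) from
          hor.comp (by fun_prop))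
    · simp only [Set.ofPred_forall]
      exact isClosed_iInter fun a => isClosed_iInter fun b => isClosed_eq (by fun_prop)
        (show Continuous ((fun p : Bool × Bool => (p.1 && p.2)) ∘
          fun x : X → Bool => (x a, x b)) from
          hand.comp (by fun_prop))
    · exact isClosed_eq (by fun_prop) (by fun_prop)
    · exact isClosed_eq (by fun_prop) (by fun_prop)
  exact Topology.IsClosedEmbedding.compactSpace ⟨Stone.isEmbedding, hc⟩

/-- The Boolean prime ideal theorem: a non-zero element belongs to an ultrafilter. -/
theorem Stone.exists_apply_eq_true {X : ProbAlg.{uX}} {a : X} (ha : a ≠ ⊥) :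
    ∃ s : Stone X, s a = true := by
  classical
  have hd : Disjoint (Order.PFilter.principal a : Set X) (Order.Ideal.principal (⊥ : X)) := by
    rw [Set.disjoint_left]
    intro b hb hb'
    have h1 : a ≤ b := Order.PFilter.mem_principal.mp hb
    have h2 : b ≤ ⊥ := Order.Ideal.mem_principal.mp hb'
    exact ha (le_bot_iff.mp (h1.trans h2))
  obtain ⟨J, hJ, -, hJd⟩ := DistribLattice.prime_ideal_of_disjoint_filter_ideal hd
  have htop : (⊤ : X) ∉ J := Set.disjoint_left.mp hJd (Order.PFilter.mem_principal.mpr le_top)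
  have haJ : a ∉ J := Set.disjoint_left.mp hJd (Order.PFilter.mem_principal.mpr le_rfl)
  let s : BoundedLatticeHom X Bool :=
    { toFun := fun b => decide (b ∉ J)
      map_sup' := fun b c => by
        by_cases hb : b ∈ J <;> by_cases hc : c ∈ J <;> simp [Order.Ideal.sup_mem_iff, hb, hc]
      map_inf' := fun b c => by
        by_cases hb : b ∈ J
        · simpa [hb] using J.lower inf_le_left hb
        · by_cases hc : c ∈ J
          · simpa [hb, hc] using J.lower inf_le_right hc
          · have : b ⊓ c ∉ J := fun h => (hJ.mem_or_mem h).elim hb hc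
            simp [hb, hc, this]
      map_top' := by simp [htop]
      map_bot' := by simp }
  exact ⟨s, show decide (a ∉ J) = true by simpa using haJ⟩

theorem ProbAlg.basicClopen_injective (X : ProbAlg.{uX}) :
    Function.Injective X.basicClopen := by
  have key : ∀ a b : X, X.basicClopen a = X.basicClopen b → a ≤ b := by
    intro a b h
    rw [← sdiff_eq_bot_iff]
    by_contra hne
    obtain ⟨s, hs⟩ := Stone.exists_apply_eq_true hne
    have ha : s a = true := top_le_iff.mp
      (hs.symm.le.trans (OrderHomClass.mono s (sdiff_le : a \ b ≤ a)))
    have hb : s b = true := by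
      have : s ∈ X.basicClopen b := h ▸ ha
      exact this
    have hi : s ((a \ b) ⊓ b) = true := by rw [map_inf, hs, hb]; rfl
    simp at hi
  exact fun a b h => le_antisymm (key a b h) (key b a h.symm)

theorem ProbAlg.basicClopen_sup (X : ProbAlg.{uX}) (a b : X) :
    X.basicClopen (a ⊔ b) = X.basicClopen a ∪ X.basicClopen b := by
  ext s; simp

theorem ProbAlg.basicClopen_inf (X : ProbAlg.{uX}) (a b : X) :
    X.basicClopen (a ⊓ b) = X.basicClopen a ∩ X.basicClopen b := by
  ext s; simp

theorem ProbAlg.basicClopen_bot (X : ProbAlg.{uX}) : X.basicClopen ⊥ = ∅ := by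
  ext s; simp

theorem ProbAlg.basicClopen_top (X : ProbAlg.{uX}) : X.basicClopen ⊤ = Set.univ := by
  ext s; simp

theorem ProbAlg.basicClopen_compl (X : ProbAlg.{uX}) (a : X) :
    X.basicClopen aᶜ = (X.basicClopen a)ᶜ := by
  refine (IsCompl.compl_eq ?_).symm
  refine ⟨Set.disjoint_iff_inter_eq_empty.mpr ?_, codisjoint_iff.mpr ?_⟩
  · rw [← X.basicClopen_inf, inf_compl_self, X.basicClopen_bot]
  · change X.basicClopen a ∪ X.basicClopen aᶜ = Set.univ
    rw [← X.basicClopen_sup, sup_compl_eq_top, X.basicClopen_top]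

theorem ProbAlg.basicClopen_sdiff (X : ProbAlg.{uX}) (a b : X) :
    X.basicClopen (a \ b) = X.basicClopen a \ X.basicClopen b := by
  rw [sdiff_eq, X.basicClopen_inf, X.basicClopen_compl, Set.sdiff_eq]

theorem Stone.map_id {X : ProbAlg.{uX}} (s : Stone X) : Stone.map (ProbAlg.Hom.id X) s = s := rfl

theorem Stone.map_comp {X : ProbAlg.{uX}} {Y : ProbAlg.{uY}} {Z : ProbAlg.{uZ}}
    (S : ProbAlg.Hom Y Z) (T : ProbAlg.Hom X Y) (s : Stone X) :
    Stone.map (S.comp T) s = Stone.map S (Stone.map T s) := rfl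

/-- Canonical representations are compatible with composition by a morphism. -/
theorem Cond.rep_comp {X : ProbAlg.{uX}} {Y : ProbAlg.{uY}} {Z : Type uZ} [TopologicalSpace Z]
    [CompactSpace Z] [T2Space Z] (a : Cond Y Z) (T : ProbAlg.Hom X Y) (s : Stone X) :
    (a.comp T).rep s = a.rep (Stone.map T s) := by
  by_contra hne
  obtain ⟨U, V, hU, hV, hUm, hVm, hUV⟩ := t2_separation hne
  obtain ⟨E, F, hE, hF, -, hle⟩ := BaireSet.exists_separating _ U (hU.mem_nhds hUm)
  obtain ⟨E', F', hE', hF', -, hle'⟩ := BaireSet.exists_separating _ V (hV.mem_nhds hVm)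
  have h1 : s (T.pullback (a.pullback E)) = true := (a.comp T).rep_spec s E hE
  have h2 : s (T.pullback (a.pullback E')) = true := a.rep_spec (Stone.map T s) E' hE'
  have hbot : E ⊓ E' = ⊥ := by
    rw [← disjoint_iff]
    refine Disjoint.mono hle hle' (disjoint_iff.mpr (Subtype.ext ?_))
    exact Set.disjoint_iff_inter_eq_empty.mp (hUV.mono hF hF')
  have : s (T.pullback (a.pullback (E ⊓ E'))) = true := by
    rw [map_inf, map_inf, map_inf, h1, h2]; rfl
  rw [hbot] at this
  simp at this

/-- To identify a product of conditional elements it is enough to test it on Baire sets, of which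
the first may be taken closed, without reference to ultrafilters. -/
theorem Cond.isSMul_of_inf_eq_bot {X : ProbAlg.{uX}} {K : Type uK} {Z : Type uZ}
    [TopologicalSpace K] [CompactSpace K] [T2Space K] [TopologicalSpace Z] [CompactSpace Z]
    [T2Space Z] [SMul K Z] [ContinuousSMul K Z] {c : Cond X Z} {a : Cond X K} {b : Cond X Z}
    (h : ∀ (E : BaireSet K) (F G : BaireSet Z), IsClosed E.1 → (∀ x ∈ E.1, ∀ y ∈ F.1, x • y ∉ G.1) →
      a.pullback E ⊓ b.pullback F ⊓ c.pullback G = ⊥) : c.IsSMul a b := by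
  intro s
  by_contra hne
  obtain ⟨V, U, hV, hU, hVm, hUm, hUV⟩ := t2_separation hne
  have hpre : (fun p : K × Z => p.1 • p.2) ⁻¹' U ∈ nhds (a.rep s, b.rep s) :=
    (hU.preimage continuous_smul).mem_nhds hUm
  obtain ⟨U₁, hU₁, U₂, hU₂, hsub⟩ := mem_nhds_prod_iff.mp hpre
  obtain ⟨E, E', hE, hE', hEc, hEle⟩ := BaireSet.exists_separating _ U₁ hU₁
  obtain ⟨F, F', hF, hF', -, hFle⟩ := BaireSet.exists_separating _ U₂ hU₂
  obtain ⟨G, G', hG, hG', -, hGle⟩ := BaireSet.exists_separating _ V (hV.mem_nhds hVm)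
  have hbot := h E' F' G' hEc fun x hx y hy hxy =>
    Set.disjoint_left.mp hUV (hG' hxy) (hsub (Set.mk_mem_prod (hE' hx) (hF' hy)))
  have h1 := a.rep_spec s E' (Filter.mem_of_superset hE hEle)
  have h2 := b.rep_spec s F' (Filter.mem_of_superset hF hFle)
  have h3 := c.rep_spec s G' (Filter.mem_of_superset hG hGle)
  have : s (a.pullback E' ⊓ b.pullback F' ⊓ c.pullback G') = true := by
    rw [map_inf, map_inf, h1, h2, h3]; rfl
  rw [hbot] at this
  simp at this

theorem measurableSet_baire_preimage {Z : Type uZ} [TopologicalSpace Z] (f : C(Z, ℂ)) {V : Set ℂ}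
    (hV : MeasurableSet V) : @MeasurableSet Z (baire Z) (f ⁻¹' V) :=
  le_iSup (fun f : C(Z, ℂ) => MeasurableSpace.comap f (borel ℂ)) f _
    ⟨V, by rwa [← BorelSpace.measurable_eq], rfl⟩

/-- Conditional elements are determined by their values on closed Baire sets, compared with those
on open Baire neighbourhoods. The hypothesis is symmetric in `c` and `d`, by complementation. -/
theorem Cond.ext_of_closed_le_open {X : ProbAlg.{uX}} {Z : Type uZ} [TopologicalSpace Z]
    {c d : Cond X Z} (h : ∀ E F : BaireSet Z, IsOpen E.1 → IsClosed F.1 → F.1 ⊆ E.1 →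
      c.pullback F ≤ d.pullback E) : c = d := by
  have hle : ∀ c d : Cond X Z, (∀ E F : BaireSet Z, IsOpen E.1 → IsClosed F.1 → F.1 ⊆ E.1 →
      c.pullback F ≤ d.pullback E) → ∀ (f : C(Z, ℂ)) (U : Set ℂ) (hU : IsOpen U),
      c.pullback ⟨f ⁻¹' U, measurableSet_baire_preimage f hU.measurableSet⟩ ≤
      d.pullback ⟨f ⁻¹' U, measurableSet_baire_preimage f hU.measurableSet⟩ := by
    intro c d h f U hU
    -- An open subset of `ℂ` is a countable union of closed sets.
    obtain ⟨F, hFc, hFU, hF, -⟩ := hU.exists_iUnion_isClosed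
    let F' : ℕ → BaireSet Z := fun n =>
      ⟨f ⁻¹' F n, measurableSet_baire_preimage f (hFc n).measurableSet⟩
    have he : (⟨f ⁻¹' U, measurableSet_baire_preimage f hU.measurableSet⟩ : BaireSet Z) =
        BaireSet.iUnion F' := by
      have : f ⁻¹' U = ⋃ n, f ⁻¹' F n := by rw [← hF, Set.preimage_iUnion]
      exact Subtype.ext this
    rw [he]
    refine (c.isLUB_pullback F').2 ?_
    rintro _ ⟨n, rfl⟩
    rw [← he]
    exact h _ _ (hU.preimage f.continuous) ((hFc n).preimage f.continuous)
      (Set.preimage_mono (hFU n))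
  have h' : ∀ E F : BaireSet Z, IsOpen E.1 → IsClosed F.1 → F.1 ⊆ E.1 →
      d.pullback F ≤ c.pullback E := by
    intro E F hE hF hFE
    have := h Fᶜ Eᶜ hF.isOpen_compl hE.isClosed_compl (Set.compl_subset_compl.mpr hFE)
    rw [map_compl', map_compl'] at this
    exact compl_le_compl_iff_le.mp this
  let m : MeasurableSpace Z :=
    { MeasurableSet' := fun E => ∃ hE : @MeasurableSet Z (baire Z) E,
        c.pullback ⟨E, hE⟩ = d.pullback ⟨E, hE⟩
      measurableSet_empty := ⟨@MeasurableSet.empty Z (baire Z), by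
        exact (map_bot c.pullback).trans (map_bot d.pullback).symm⟩
      measurableSet_compl := by
        rintro E ⟨hE, he⟩
        refine ⟨@MeasurableSet.compl Z E (baire Z) hE, ?_⟩
        have hc := map_compl' c.pullback ⟨E, hE⟩
        have hd := map_compl' d.pullback ⟨E, hE⟩
        exact hc.trans ((congrArg _ he).trans hd.symm)
      measurableSet_iUnion := by
        intro E hE
        choose hE he using hE
        refine ⟨@MeasurableSet.iUnion Z ℕ (baire Z) _ _ hE, ?_⟩
        have hc := c.isLUB_pullback fun n => ⟨E n, hE n⟩
        have hd := d.isLUB_pullback fun n => ⟨E n, hE n⟩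
        rw [show (fun n => c.pullback ⟨E n, hE n⟩) = fun n => d.pullback ⟨E n, hE n⟩ from
          funext he] at hc
        exact hc.unique hd }
  have hm : baire Z ≤ m := by
    refine iSup_le fun f => ?_
    rw [← BorelSpace.measurable_eq, ← measurable_iff_comap_le]
    exact measurable_of_isOpen fun U hU =>
      ⟨measurableSet_baire_preimage f hU.measurableSet,
        le_antisymm (hle c d h f U hU) (hle d c h' f U hU)⟩
  refine Cond.ext (DFunLike.ext _ _ fun E => ?_)
  exact (hm E.1 E.2).2

/-! ### Invariant set functions on an ergodic system -/

theorem ProbAlg.eq_of_le_of_μ_le (X : ProbAlg.{uX}) {a b : X} (h : a ≤ b) (hμ : X.μ b ≤ X.μ a) :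
    b = a := by
  refine le_antisymm (sdiff_eq_bot_iff.mp ?_) h
  by_contra hne
  have h1 := X.μ_sup (disjoint_sdiff_self_right (x := a) (y := b))
  rw [sup_sdiff_cancel_right h] at h1
  linarith [X.μ_pos _ hne]

/-- A countable exhaustion: strict positivity of the measure makes increasing sequences suffice
in Zorn's lemma. -/
theorem ProbAlg.exists_maximal (X : ProbAlg.{uX}) (P : Set X) (hne : P.Nonempty)
    (hP : ∀ f : ℕ → X, Monotone f → (∀ n, f n ∈ P) → ∀ a, IsLUB (Set.range f) a → a ∈ P) :
    ∃ a ∈ P, ∀ b ∈ P, a ≤ b → b = a := by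
  obtain ⟨x, hx⟩ := hne
  suffices hchain : ∀ c ⊆ P, IsChain (· ≤ ·) c → ∀ y ∈ c, ∃ ub ∈ P, ∀ z ∈ c, z ≤ ub by
    obtain ⟨m, -, hm⟩ := zorn_le_nonempty₀ P hchain x hx
    exact ⟨m, hm.1, fun b hb hmb => le_antisymm (hm.2 hb hmb) hmb⟩
  intro c hcP hc y hy
  have hbdd : BddAbove (X.μ '' c) := ⟨1, by
    rintro _ ⟨z, -, rfl⟩
    rw [← X.μ_top]
    exact X.μ_mono le_top⟩
  -- A countable part of the chain approaches the supremum of the measures. Its join bounds the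
  -- whole chain: a member above that part has no more measure than the join.
  obtain ⟨u, -, hu, huc⟩ := exists_seq_tendsto_sSup (⟨_, y, hy, rfl⟩ : (X.μ '' c).Nonempty) hbdd
  choose v hvc hvu using huc
  have hps : ∀ n, partialSups v n ∈ c := by
    intro n
    induction n with
    | zero => simpa using hvc 0
    | succ n ih =>
      rw [partialSups_add_one]
      rcases hc.total ih (hvc (n + 1)) with h | h
      · rw [sup_eq_right.mpr h]; exact hvc _
      · rw [sup_eq_left.mpr h]; exact ih
  obtain ⟨a, ha⟩ := X.sigmaComplete (partialSups v)
  refine ⟨a, hP _ (partialSups v).monotone (fun n => hcP (hps n)) a ha, fun z hz => ?_⟩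
  by_cases hex : ∃ n, z ≤ v n
  · obtain ⟨n, hn⟩ := hex
    exact hn.trans ((le_partialSups v n).trans (ha.1 ⟨n, rfl⟩))
  · push Not at hex
    have hvz : ∀ n, v n ≤ z := fun n => (hc.total hz (hvc n)).resolve_left (hex n)
    have haz : a ≤ z := ha.2 (by
      rintro _ ⟨n, rfl⟩
      exact partialSups_le v n z fun i _ => hvz i)
    refine (X.eq_of_le_of_μ_le haz ?_).le
    refine (le_csSup hbdd ⟨z, hz, rfl⟩).trans (le_of_tendsto' hu fun n => ?_)
    rw [← hvu]
    exact X.μ_mono ((le_partialSups v n).trans (ha.1 ⟨n, rfl⟩))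

section SetFunction

variable {X : ProbAlg.{uX}} {φ : X → ℝ} {C : ℝ}

theorem ProbAlg.setFunction_sdiff (hadd : ∀ a b, Disjoint a b → φ (a ⊔ b) = φ a + φ b) {a b : X}
    (h : a ≤ b) : φ (b \ a) = φ b - φ a := by
  have := hadd a (b \ a) disjoint_sdiff_self_right
  rw [sup_sdiff_cancel_right h] at this
  linarith

theorem ProbAlg.tendsto_setFunction (hadd : ∀ a b, Disjoint a b → φ (a ⊔ b) = φ a + φ b)
    (hC : ∀ a, |φ a| ≤ C * X.μ a) {f : ℕ → X} (hf : Monotone f) {a : X}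
    (ha : IsLUB (Set.range f) a) :
    Filter.Tendsto (fun n => φ (f n)) Filter.atTop (nhds (φ a)) := by
  have h1 := X.tendsto_μ_partialSups f a ha
  rw [hf.partialSups_eq] at h1
  have h2 : Filter.Tendsto (fun n => C * (X.μ a - X.μ (f n))) Filter.atTop (nhds 0) := by
    simpa using (h1.const_sub (X.μ a)).const_mul C
  rw [tendsto_iff_dist_tendsto_zero]
  refine squeeze_zero (fun _ => dist_nonneg) (fun n => ?_) h2
  have hle : f n ≤ a := ha.1 ⟨n, rfl⟩
  rw [dist_comm, Real.dist_eq, ← setFunction_sdiff hadd hle,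
    ← setFunction_sdiff (φ := X.μ) (fun _ _ => X.μ_sup) hle]
  exact hC _

theorem ProbAlg.isLUB_inf_left {f : ℕ → X} {a b : X} (ha : IsLUB (Set.range f) a) (hb : b ≤ a) :
    IsLUB (Set.range fun n => b ⊓ f n) b := by
  refine ⟨by rintro _ ⟨n, rfl⟩; exact inf_le_left, fun c hc => ?_⟩
  have h : a ≤ b ⇨ c := ha.2 (by
    rintro _ ⟨n, rfl⟩
    have h1 : b ⊓ f n ≤ c := hc ⟨n, rfl⟩
    rwa [le_himp_iff, inf_comm])
  simpa using hb.trans h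

/-- An element is positive for `φ` when `φ` is nonnegative below it. A set function that takes a
positive value has a non-zero positive element: remove a maximal element on which it is
nonpositive. -/
theorem ProbAlg.exists_positive (hadd : ∀ a b, Disjoint a b → φ (a ⊔ b) = φ a + φ b)
    (hC : ∀ a, |φ a| ≤ C * X.μ a) {a : X} (ha : 0 < φ a) :
    ∃ p, p ≠ ⊥ ∧ ∀ b ≤ p, 0 ≤ φ b := by
  have hbot : φ ⊥ = 0 := by
    have := hC ⊥
    rw [X.μ_bot, mul_zero] at this
    exact abs_nonpos_iff.mp this
  obtain ⟨m, ⟨hma, hm⟩, hmax⟩ := X.exists_maximal {c | c ≤ a ∧ φ c ≤ 0} ⟨⊥, bot_le, hbot.le⟩ (by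
    intro f hf hfP c hc
    refine ⟨hc.2 ?_, le_of_tendsto' (tendsto_setFunction hadd hC hf hc) fun n => (hfP n).2⟩
    rintro _ ⟨n, rfl⟩
    exact (hfP n).1)
  refine ⟨a \ m, fun h => ?_, fun b hb => ?_⟩
  · have := setFunction_sdiff hadd hma
    rw [h, hbot] at this
    linarith
  · by_contra! hneg
    have hd : Disjoint m b := disjoint_sdiff_self_right.mono_right hb
    have heq := hmax (m ⊔ b) ⟨sup_le hma (hb.trans sdiff_le), by
      rw [hadd _ _ hd]; linarith⟩ le_sup_left
    have : b = ⊥ := hd.eq_bot_of_ge (sup_eq_left.mp heq)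
    rw [this, hbot] at hneg
    exact lt_irrefl _ hneg

end SetFunction

/-- On an ergodic system the measure is the only invariant additive set function of total mass one
dominated by a multiple of the measure. The greatest positive element of the difference is
invariant, hence trivial. -/
theorem System.Ergodic.eq_μ {Γ : Type uG} [Group Γ] {X : System.{uX} Γ} (hX : X.Ergodic)
    {m : X.alg → ℝ} {C : ℝ} (hadd : ∀ a b, Disjoint a b → m (a ⊔ b) = m a + m b)
    (h0 : ∀ a, 0 ≤ m a) (hC : ∀ a, m a ≤ C * X.alg.μ a)
    (hinv : ∀ γ a, m ((X.T γ).pullback a) = m a) (htop : m ⊤ = 1) (a : X.alg) :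
    m a = X.alg.μ a := by
  let φ : X.alg → ℝ := fun a => m a - X.alg.μ a
  have hφadd : ∀ a b, Disjoint a b → φ (a ⊔ b) = φ a + φ b := by
    intro a b h
    simp only [φ, hadd a b h, X.alg.μ_sup h]
    ring
  have hC1 : 1 ≤ C := by
    have := hC ⊤
    rwa [htop, X.alg.μ_top, mul_one] at this
  have hφC : ∀ a, |φ a| ≤ (C + 1) * X.alg.μ a := by
    intro a
    have h1 := X.alg.μ_nonneg a
    have h2 := hC a
    have h3 := h0 a
    have h4 : 0 ≤ C * X.alg.μ a := by positivity
    rw [abs_le]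
    constructor <;> simp only [φ] <;> linarith
  have hφinv : ∀ γ a, φ ((X.T γ).pullback a) = φ a := by
    intro γ a
    simp only [φ, hinv, (X.T γ).μ_pullback]
  have hφtop : φ ⊤ = 0 := by simp [φ, htop, X.alg.μ_top]
  -- As `φ ⊤ = 0`, it is enough to show that `φ` has constant sign.
  have hcompl : ∀ a, φ aᶜ = -φ a := by
    intro a
    have := hφadd a aᶜ disjoint_compl_right
    rw [sup_compl_eq_top, hφtop] at this
    linarith
  let P : Set X.alg := {p | ∀ b ≤ p, 0 ≤ φ b}
  have hPsup : ∀ p ∈ P, ∀ q ∈ P, p ⊔ q ∈ P := by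
    intro p hp q hq b hb
    have : b = b ⊓ p ⊔ b \ p := (sup_inf_sdiff b p).symm
    rw [this, hφadd _ _ disjoint_inf_sdiff]
    refine add_nonneg (hp _ inf_le_right) (hq _ ?_)
    rwa [sdiff_le_iff]
  obtain ⟨g, hg, hmax⟩ := X.alg.exists_maximal P
    ⟨⊥, fun b hb => by rw [le_bot_iff.mp hb, ← compl_top, hcompl, hφtop, neg_zero]⟩ (by
      intro f hf hfP c hc b hb
      refine ge_of_tendsto' (ProbAlg.tendsto_setFunction hφadd hφC (f := fun n => b ⊓ f n)
        (fun i j h => inf_le_inf_left b (hf h)) (ProbAlg.isLUB_inf_left hc hb))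
        fun n => hfP n _ inf_le_right)
  have hgreatest : ∀ p ∈ P, p ≤ g := fun p hp =>
    sup_eq_left.mp (hmax (g ⊔ p) (hPsup g hg p hp) le_sup_left)
  have hTT : ∀ γ a, (X.T γ).pullback ((X.T γ⁻¹).pullback a) = a := by
    intro γ a
    have h1 := X.T_mul γ⁻¹ γ
    rw [inv_mul_cancel, X.T_one] at h1
    exact (congrArg (fun T => ProbAlg.Hom.pullback T a) h1).symm
  have hPT : ∀ γ, ∀ p ∈ P, (X.T γ).pullback p ∈ P := by
    intro γ p hp b hb
    rw [← hφinv γ⁻¹ b]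
    refine hp _ ?_
    have h1 := OrderHomClass.mono (X.T γ⁻¹).pullback hb
    have h2 := hTT γ⁻¹ p
    rw [inv_inv] at h2
    rwa [h2] at h1
  have hgT : ∀ γ, (X.T γ).pullback g = g := by
    intro γ
    refine le_antisymm (hgreatest _ (hPT γ g hg)) ?_
    have h1 := OrderHomClass.mono (X.T γ).pullback (hgreatest _ (hPT γ⁻¹ g hg))
    rwa [hTT] at h1
  have hzero : φ a = 0 := by
    rcases hX g hgT with h | h
    · have hle : ∀ b, φ b ≤ 0 := by
        intro b
        by_contra! hb
        obtain ⟨p, hp, hpP⟩ := ProbAlg.exists_positive hφadd hφC hb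
        exact hp (le_bot_iff.mp (h ▸ hgreatest p hpP))
      have := hle aᶜ
      rw [hcompl] at this
      linarith [hle a]
    · have hge : ∀ b, 0 ≤ φ b := fun b => hg b (h ▸ le_top)
      have := hge aᶜ
      rw [hcompl] at this
      linarith [hge a]
  simp only [φ] at hzero
  linarith

/-! ### The measure algebra of a probability space -/

section MeasureAlgebra

open MeasureTheory Filter

variable {Ω : Type uW} [MeasurableSpace Ω]

/-- Measurable sets up to null sets. -/
def aeEqSetoid (ν : Measure Ω) : Setoid {A : Set Ω // MeasurableSet A} where
  r A B := A.1 =ᵐ[ν] B.1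
  iseqv := ⟨fun _ => EventuallyEq.rfl, fun h => h.symm, fun h h' => h.trans h'⟩

/-- The Boolean algebra of measurable sets modulo null sets. -/
def MeasureAlgebra (ν : Measure Ω) : Type uW := Quotient (aeEqSetoid ν)

namespace MeasureAlgebra

variable {ν : Measure Ω}

/-- The class of a measurable set. -/
def mk (ν : Measure Ω) (A : Set Ω) (hA : MeasurableSet A) : MeasureAlgebra ν :=
  Quotient.mk (aeEqSetoid ν) ⟨A, hA⟩

theorem ind {p : MeasureAlgebra ν → Prop} (h : ∀ A hA, p (mk ν A hA)) (a : MeasureAlgebra ν) :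
    p a :=
  Quotient.ind (fun A => h A.1 A.2) a

theorem mk_eq_mk {A B : Set Ω} {hA : MeasurableSet A} {hB : MeasurableSet B} :
    mk ν A hA = mk ν B hB ↔ A =ᵐ[ν] B :=
  Quotient.eq (r := aeEqSetoid ν)

theorem mk_congr {A B : Set Ω} {hA : MeasurableSet A} {hB : MeasurableSet B} (h : A = B) :
    mk ν A hA = mk ν B hB := by
  subst h
  rfl

instance : LE (MeasureAlgebra ν) where
  le := Quotient.lift₂ (fun A B => A.1 ≤ᵐ[ν] B.1) fun _ _ _ _ h h' =>
    propext ⟨fun hle => (h.symm.le.trans hle).trans h'.le, fun hle =>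
      (h.le.trans hle).trans h'.symm.le⟩

theorem mk_le_mk {A B : Set Ω} {hA : MeasurableSet A} {hB : MeasurableSet B} :
    mk ν A hA ≤ mk ν B hB ↔ A ≤ᵐ[ν] B := Iff.rfl

theorem mk_mono {A B : Set Ω} {hA : MeasurableSet A} {hB : MeasurableSet B} (h : A ⊆ B) :
    mk ν A hA ≤ mk ν B hB :=
  mk_le_mk.mpr (LE.le.eventuallyLE h)

instance : Max (MeasureAlgebra ν) where
  max := Quotient.map₂ (fun A B => ⟨A.1 ∪ B.1, A.2.union B.2⟩) fun _ _ h _ _ h' => h.union h'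

instance : Min (MeasureAlgebra ν) where
  min := Quotient.map₂ (fun A B => ⟨A.1 ∩ B.1, A.2.inter B.2⟩) fun _ _ h _ _ h' => h.inter h'

instance : Compl (MeasureAlgebra ν) where
  compl := Quotient.map (fun A => ⟨A.1ᶜ, A.2.compl⟩) fun _ _ h => h.compl

instance : Top (MeasureAlgebra ν) := ⟨mk ν Set.univ MeasurableSet.univ⟩

instance : Bot (MeasureAlgebra ν) := ⟨mk ν ∅ MeasurableSet.empty⟩

instance : BooleanAlgebra (MeasureAlgebra ν) where
  sup a b := a ⊔ b
  inf a b := a ⊓ b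
  le_refl := ind fun _ _ => mk_mono subset_rfl
  le_trans := ind fun _ _ => ind fun _ _ => ind fun _ _ => fun h h' => EventuallyLE.trans h h'
  le_antisymm := ind fun _ _ => ind fun _ _ => fun h h' =>
    mk_eq_mk.mpr (EventuallyLE.antisymm h h')
  le_sup_left := ind fun _ _ => ind fun _ _ => mk_mono Set.subset_union_left
  le_sup_right := ind fun _ _ => ind fun _ _ => mk_mono Set.subset_union_right
  sup_le := ind fun _ _ => ind fun _ _ => ind fun _ _ => fun h h' => by
    filter_upwards [h, h'] with x hx hx' hxx
    exact hxx.elim hx hx'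
  inf_le_left := ind fun _ _ => ind fun _ _ => mk_mono Set.inter_subset_left
  inf_le_right := ind fun _ _ => ind fun _ _ => mk_mono Set.inter_subset_right
  le_inf := ind fun _ _ => ind fun _ _ => ind fun _ _ => fun h h' => by
    filter_upwards [h, h'] with x hx hx' hxx
    exact ⟨hx hxx, hx' hxx⟩
  le_sup_inf := ind fun _ _ => ind fun _ _ => ind fun _ _ =>
    mk_mono (Set.union_inter_distrib_left _ _ _).ge
  inf_compl_le_bot := ind fun _ _ => mk_mono (Set.inter_compl_self _).le
  top_le_sup_compl := ind fun _ _ => mk_mono (Set.union_compl_self _).ge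
  le_top := ind fun _ _ => mk_mono (Set.subset_univ _)
  bot_le := ind fun _ _ => mk_mono (Set.empty_subset _)

theorem isLUB_mk_iUnion {A : ℕ → Set Ω} (hA : ∀ n, MeasurableSet (A n)) :
    IsLUB (Set.range fun n => mk ν (A n) (hA n)) (mk ν (⋃ n, A n) (MeasurableSet.iUnion hA)) := by
  refine ⟨?_, ind fun B hB h => ?_⟩
  · rintro _ ⟨n, rfl⟩
    exact mk_mono (Set.subset_iUnion A n)
  · have h' : ∀ n, A n ≤ᵐ[ν] B := fun n => h ⟨n, rfl⟩
    rw [mk_le_mk]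
    filter_upwards [ae_all_iff.mpr h'] with x hx hxA
    obtain ⟨n, hn⟩ := Set.mem_iUnion.mp hxA
    exact hx n hn

end MeasureAlgebra

open MeasureAlgebra

/-- The probability algebra of a probability space. -/
noncomputable def measureProbAlg (ν : Measure Ω) [IsProbabilityMeasure ν] : ProbAlg.{uW} where
  carrier := MeasureAlgebra ν
  sigmaComplete f := by
    choose A hA using fun n => Quotient.exists_rep (f n)
    refine ⟨_, (?_ : f = fun n => mk ν (A n).1 (A n).2) ▸ isLUB_mk_iUnion fun n => (A n).2⟩
    exact funext fun n => (hA n).symm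
  μ := Quotient.lift (fun A => ν.real A.1) fun _ _ h => measureReal_congr h
  μ_nonneg := ind fun _ _ => measureReal_nonneg
  μ_top := probReal_univ (μ := ν)
  μ_sigma f hd a ha := by
    choose A hA using fun n => Quotient.exists_rep (f n)
    obtain rfl : f = fun n => mk ν (A n).1 (A n).2 := funext fun n => (hA n).symm
    obtain rfl := ha.unique (isLUB_mk_iUnion fun n => (A n).2)
    have hd' : Pairwise (Function.onFun (AEDisjoint ν) fun n => (A n).1) := by
      intro m n hmn
      have h := (hd hmn).eq_bot
      have h' : ((A m).1 ∩ (A n).1 : Set Ω) =ᵐ[ν] (∅ : Set Ω) := mk_eq_mk.mp h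
      exact ae_eq_empty.mp h'
    have hs := measure_iUnion₀ hd' fun n => (A n).2.nullMeasurableSet
    have := ENNReal.hasSum_toReal (f := fun n => ν (A n).1) (hs ▸ measure_ne_top ν _)
    rw [← ENNReal.tsum_toReal_eq fun n => measure_ne_top ν _, ← hs] at this
    exact this
  μ_pos := ind fun A hA hne => by
    have h0 : ν A ≠ 0 := fun h => hne (mk_eq_mk.mpr (ae_eq_empty.mpr h))
    exact ENNReal.toReal_pos h0 (measure_ne_top ν A)

variable {ν : Measure Ω} [IsProbabilityMeasure ν]

/-- A family of measurable sets indexed by a probability algebra, compatible with the Boolean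
operations and the measures, defines a morphism. -/
noncomputable def homOfSets {X : ProbAlg.{uX}} (A : X → Set Ω) (hA : ∀ a, MeasurableSet (A a))
    (hsup : ∀ a b, A (a ⊔ b) = A a ∪ A b) (hinf : ∀ a b, A (a ⊓ b) = A a ∩ A b)
    (htop : A ⊤ = Set.univ) (hbot : A ⊥ = ∅) (hμ : ∀ a, ν.real (A a) = X.μ a) :
    ProbAlg.Hom (measureProbAlg ν) X where
  pullback :=
    { toFun := fun a => mk ν (A a) (hA a)
      map_sup' := fun a b => mk_congr (hsup a b)
      map_inf' := fun a b => mk_congr (hinf a b)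
      map_top' := mk_congr htop
      map_bot' := mk_congr hbot }
  μ_pullback := hμ

/-- The endomorphism of the measure algebra defined by a measure-preserving map. -/
noncomputable def homOfMap (g : Ω → Ω) (hg : MeasurePreserving g ν ν) :
    ProbAlg.Hom (measureProbAlg ν) (measureProbAlg ν) where
  pullback :=
    { toFun := Quotient.map (fun A => ⟨g ⁻¹' A.1, hg.measurable A.2⟩) fun _ _ h =>
        hg.quasiMeasurePreserving.preimage_ae_eq h
      map_sup' := ind fun _ _ => ind fun _ _ => rfl
      map_inf' := ind fun _ _ => ind fun _ _ => rfl
      map_top' := rfl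
      map_bot' := rfl }
  μ_pullback := ind fun _ hA => hg.measureReal_preimage hA.nullMeasurableSet

/-- The conditional element defined by a map to a topological space that is measurable for the
Baire sets. -/
noncomputable def condOfMap {Z : Type uZ} [TopologicalSpace Z] (g : Ω → Z)
    (hg : ∀ E : BaireSet Z, MeasurableSet (g ⁻¹' E.1)) : Cond (measureProbAlg ν) Z where
  pullback :=
    { toFun := fun E => mk ν (g ⁻¹' E.1) (hg E)
      map_sup' := fun _ _ => rfl
      map_inf' := fun _ _ => rfl
      map_top' := rfl
      map_bot' := rfl }
  isLUB_pullback E := by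
    have h := isLUB_mk_iUnion (ν := ν) fun n => hg (E n)
    have he : ⋃ n, g ⁻¹' (E n).1 = g ⁻¹' (BaireSet.iUnion E).1 := Set.preimage_iUnion.symm
    have hm : mk ν (⋃ n, g ⁻¹' (E n).1) (MeasurableSet.iUnion fun n => hg (E n)) =
        mk ν (g ⁻¹' (BaireSet.iUnion E).1) (hg _) := mk_congr he
    rw [hm] at h
    exact h

end MeasureAlgebra

/-! ### Generation by continuous functions that separate points -/

section Generation

open MeasureTheory Filter

/-- By the Stone-Weierstrass theorem, a σ-algebra for which the members of a separating family of
continuous functions are measurable makes all continuous functions measurable. -/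
theorem measurable_continuousMap_of_separates {Ω : Type uW} [TopologicalSpace Ω] [CompactSpace Ω]
    (m : MeasurableSpace Ω)
    (h : ∀ x y : Ω, x ≠ y → ∃ f : C(Ω, ℝ), Measurable f ∧ f x ≠ f y) (f : C(Ω, ℝ)) :
    Measurable f := by
  let A : Subalgebra ℝ C(Ω, ℝ) :=
    { carrier := {f | Measurable f}
      mul_mem' := fun hf hg => Measurable.mul hf hg
      add_mem' := fun hf hg => Measurable.add hf hg
      algebraMap_mem' := fun r => measurable_const (a := r) }
  have hA := ContinuousMap.subalgebra_topologicalClosure_eq_top_of_separatesPoints A (by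
    intro x y hxy
    obtain ⟨f, hf, hne⟩ := h x y hxy
    exact ⟨f, ⟨f, hf, rfl⟩, hne⟩)
  have hf : f ∈ A.topologicalClosure := hA ▸ Algebra.mem_top
  obtain ⟨u, hu, hlim⟩ := mem_closure_iff_seq_limit.mp hf
  refine measurable_of_tendsto_metrizable (f := fun n => u n) hu ?_
  rw [tendsto_pi_nhds]
  exact fun x => ((continuous_eval_const x).tendsto f).comp hlim

open MeasureAlgebra in
/-- The measurable sets whose classes belong to a given σ-complete Boolean subalgebra. -/
@[reducible]
def classMeasurableSpace {Ω : Type uW} [MeasurableSpace Ω] {ν : Measure Ω} [IsProbabilityMeasure ν]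
    {S : Set (measureProbAlg ν)} (hbot : ⊥ ∈ S) (hcompl : ∀ a ∈ S, aᶜ ∈ S)
    (hlub : ∀ f : ℕ → measureProbAlg ν, (∀ n, f n ∈ S) → ∀ a, IsLUB (Set.range f) a → a ∈ S) :
    MeasurableSpace Ω where
  MeasurableSet' := fun A => ∃ hA : MeasurableSet A, mk ν A hA ∈ S
  measurableSet_empty := ⟨MeasurableSet.empty, hbot⟩
  measurableSet_compl := fun A ⟨hA, hAS⟩ => ⟨hA.compl, hcompl _ hAS⟩
  measurableSet_iUnion := fun A hA => by
    choose hA hAS using hA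
    exact ⟨MeasurableSet.iUnion hA, hlub _ hAS _ (isLUB_mk_iUnion hA)⟩

open MeasureAlgebra in
/-- In the measure algebra of a regular Borel measure on a compact Hausdorff space, a σ-complete
Boolean subalgebra is everything as soon as the continuous functions that are measurable for it
separate points. -/
theorem mem_of_separates {Ω : Type uW} [TopologicalSpace Ω] [CompactSpace Ω] [T2Space Ω]
    [MeasurableSpace Ω] [BorelSpace Ω] {ν : Measure Ω} [IsProbabilityMeasure ν] [ν.Regular]
    {S : Set (measureProbAlg ν)} (hbot : ⊥ ∈ S) (hcompl : ∀ a ∈ S, aᶜ ∈ S)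
    (hlub : ∀ f : ℕ → measureProbAlg ν, (∀ n, f n ∈ S) → ∀ a, IsLUB (Set.range f) a → a ∈ S)
    (h : ∀ x y : Ω, x ≠ y → ∃ f : C(Ω, ℝ), f x ≠ f y ∧
      ∀ (V : Set ℝ) (hV : IsOpen V), mk ν (f ⁻¹' V) (f.continuous.measurable hV.measurableSet) ∈ S)
    (a : measureProbAlg ν) : a ∈ S := by
  have hcont : ∀ f : C(Ω, ℝ), Measurable[classMeasurableSpace hbot hcompl hlub] f := by
    refine measurable_continuousMap_of_separates _ fun x y hxy => ?_
    obtain ⟨f, hne, hf⟩ := h x y hxy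
    exact ⟨f, @measurable_of_isOpen _ _ _ _ _ (classMeasurableSpace hbot hcompl hlub) _
      fun V hV => ⟨_, hf V hV⟩, hne⟩
  have hopen : ∀ U : Set Ω, IsOpen U → MeasurableSet[classMeasurableSpace hbot hcompl hlub] U := by
    intro U hU
    -- Inner regularity and Urysohn functions exhaust `U`, up to a null set, by preimages of
    -- half-lines under continuous functions.
    have hex : ∀ n : ℕ, ∃ V : Set Ω, MeasurableSet[classMeasurableSpace hbot hcompl hlub] V ∧
        V ⊆ U ∧ ν (U \ V) < ((n : ENNReal) + 1)⁻¹ := by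
      intro n
      obtain ⟨C, hCU, hC, hlt⟩ := hU.measurableSet.exists_isCompact_sdiff_lt (μ := ν)
        (measure_ne_top ν U) (ε := ((n : ENNReal) + 1)⁻¹) (by simp)
      obtain ⟨f, hf0, hf1, -⟩ := exists_continuous_zero_one_of_isClosed
        hU.isClosed_compl hC.isClosed (Set.disjoint_compl_left_iff_subset.mpr hCU)
      refine ⟨f ⁻¹' Set.Ioi (1 / 2), hcont f measurableSet_Ioi, fun x hx => ?_, ?_⟩
      · by_contra hxU
        have h0 : f x = 0 := hf0 hxU
        rw [Set.mem_preimage, h0, Set.mem_Ioi] at hx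
        norm_num at hx
      · refine (measure_mono (Set.sdiff_subset_sdiff_right fun x hx => ?_)).trans_lt hlt
        have h1 : f x = 1 := hf1 hx
        rw [Set.mem_preimage, h1, Set.mem_Ioi]
        norm_num
    choose V hV hVU hlt using hex
    obtain ⟨hm, hS⟩ := @MeasurableSet.iUnion _ _ (classMeasurableSpace hbot hcompl hlub) _ _ hV
    have hzero : ν (U \ ⋃ n, V n) = 0 := by
      refine le_antisymm (ge_of_tendsto' ENNReal.tendsto_inv_nat_nhds_zero
        fun n => ?_) zero_le
      refine (measure_mono (Set.sdiff_subset_sdiff_right (Set.subset_iUnion V n))).trans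
        ((hlt n).le.trans ?_)
      exact ENNReal.inv_le_inv.mpr le_self_add
    have hae : (⋃ n, V n : Set Ω) =ᵐ[ν] U :=
      (LE.le.eventuallyLE (Set.iUnion_subset hVU)).antisymm (ae_le_set.mpr hzero)
    exact ⟨hU.measurableSet, (mk_eq_mk (hB := hU.measurableSet)).mpr hae ▸ hS⟩
  have hle : ‹MeasurableSpace Ω› ≤ classMeasurableSpace hbot hcompl hlub :=
    (BorelSpace.measurable_eq (α := Ω)).le.trans (MeasurableSpace.generateFrom_le hopen)
  revert a
  exact ind fun A hA => (hle A hA).2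

end Generation

/-! ### Ergodic measures over an ergodic system -/

section ErgodicLift

open MeasureTheory Filter

/-- The Riesz-Markov-Kakutani theorem for functionals on all of `C(W, ℝ)`, `W` compact. -/
theorem exists_regular_measure_of_positive {W : Type uW} [TopologicalSpace W] [CompactSpace W]
    [T2Space W] [MeasurableSpace W] [BorelSpace W] (I : C(W, ℝ) → ℝ)
    (hadd : ∀ f g, I (f + g) = I f + I g) (hsmul : ∀ (c : ℝ) f, I (c • f) = c * I f)
    (hnonneg : ∀ f, 0 ≤ f → 0 ≤ I f) :
    ∃ ν : Measure W, ν.Regular ∧ IsFiniteMeasure ν ∧ ∀ f : C(W, ℝ), ∫ w, f w ∂ν = I f := by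
  let Λ : CompactlySupportedContinuousMap W ℝ →ₚ[ℝ] ℝ :=
    { toFun := fun g => I g.toContinuousMap
      map_add' := fun g g' => hadd _ _
      map_smul' := fun c g => hsmul c _
      monotone' := fun g g' h => by
        have h0 : I (g'.toContinuousMap + (-1 : ℝ) • g.toContinuousMap) =
            I g'.toContinuousMap - I g.toContinuousMap := by
          rw [hadd, hsmul]; ring
        have h1 := hnonneg (g'.toContinuousMap + (-1 : ℝ) • g.toContinuousMap) (by
          intro w
          have : g w ≤ g' w := h w
          simpa using this)
        change I g.toContinuousMap ≤ I g'.toContinuousMap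
        linarith }
  refine ⟨RealRMK.rieszMeasure Λ, inferInstance, inferInstance, fun f => ?_⟩
  exact RealRMK.integral_rieszMeasure Λ
    ⟨f, HasCompactSupport.of_compactSpace _⟩

theorem measure_eq_of_integral_continuousMap_eq {W : Type uW} [TopologicalSpace W]
    [CompactSpace W] [T2Space W] [MeasurableSpace W] [BorelSpace W] {ν ν' : Measure W}
    [ν.Regular] [ν'.Regular] (h : ∀ f : C(W, ℝ), ∫ w, f w ∂ν = ∫ w, f w ∂ν') : ν = ν' :=
  Measure.ext_of_integral_eq_on_compactlySupported fun f => h f.toContinuousMap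

/-- The indicator function of a basic clopen set. -/
noncomputable def ProbAlg.indicator (X : ProbAlg.{uX}) (a : X) : C(Stone X, ℝ) where
  toFun := (X.basicClopen a).indicator 1
  continuous_toFun := (X.isClopen_basicClopen a).continuous_indicator continuous_one

/-- The positive linear functionals on `C(W, ℝ)` that represent the `τ`-invariant measures on `W`
whose marginal, along a map `q` from `W` to the Stone space of `X`, is the measure of `X`. -/
structure IsInvariantLift {Γ : Type uG} [Group Γ] (X : System.{uX} Γ) {W : Type uW}
    [TopologicalSpace W] (q : C(W, Stone X.alg)) (τ : Γ → C(W, W)) (I : C(W, ℝ) → ℝ) : Prop where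
  map_add : ∀ f g, I (f + g) = I f + I g
  map_smul : ∀ (c : ℝ) f, I (c • f) = c * I f
  nonneg : ∀ f, 0 ≤ f → 0 ≤ I f
  invariant : ∀ γ f, I (f.comp (τ γ)) = I f
  marginal : ∀ a, I ((X.alg.indicator a).comp q) = X.alg.μ a

variable {Γ : Type uG} [Group Γ] {X : System.{uX} Γ} {W : Type uW} [TopologicalSpace W]
  {q : C(W, Stone X.alg)} {τ : Γ → C(W, W)}

theorem ProbAlg.indicator_top_comp {X : ProbAlg.{uX}} (q : C(W, Stone X)) :
    (X.indicator ⊤).comp q = 1 := by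
  ext w
  simp [indicator, X.basicClopen_top]

theorem IsInvariantLift.abs_le [CompactSpace W] {I : C(W, ℝ) → ℝ}
    (hI : IsInvariantLift X q τ I) (f : C(W, ℝ)) : |I f| ≤ ‖f‖ := by
  have h1 : I 1 = 1 := by
    rw [← ProbAlg.indicator_top_comp q, hI.marginal, X.alg.μ_top]
  have hb : ∀ c : ℝ, |c| = 1 → c * I f ≤ ‖f‖ := by
    intro c hc
    have h := hI.nonneg (‖f‖ • (1 : C(W, ℝ)) + (-c) • f) (by
      intro w
      have hw := f.norm_coe_le_norm w
      have : c * f w ≤ ‖f‖ := by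
        refine (le_abs_self _).trans ?_
        rw [abs_mul, hc, one_mul]
        exact hw
      change 0 ≤ ‖f‖ * 1 + -c * f w
      linarith)
    rw [hI.map_add, hI.map_smul, hI.map_smul, h1] at h
    linarith
  rw [_root_.abs_le]
  constructor
  · linarith [hb (-1) (by simp)]
  · linarith [hb 1 (by simp)]

/-- The invariant lifts form a closed subset of a product of compact intervals. -/
theorem isCompact_isInvariantLift [CompactSpace W] :
    IsCompact {I : C(W, ℝ) → ℝ | IsInvariantLift X q τ I} := by
  have hsub : {I : C(W, ℝ) → ℝ | IsInvariantLift X q τ I} ⊆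
      Set.pi Set.univ fun f => Set.Icc (-‖f‖) ‖f‖ :=
    fun I hI f _ => _root_.abs_le.mp (IsInvariantLift.abs_le hI f)
  refine (isCompact_univ_pi fun f => isCompact_Icc).of_isClosed_subset ?_ hsub
  have heq : {I : C(W, ℝ) → ℝ | IsInvariantLift X q τ I} =
      {I | ((((∀ f g, I (f + g) = I f + I g) ∧ ∀ (c : ℝ) f, I (c • f) = c * I f) ∧
        ∀ f, 0 ≤ f → 0 ≤ I f) ∧ ∀ γ f, I (f.comp (τ γ)) = I f) ∧
        ∀ a, I ((X.alg.indicator a).comp q) = X.alg.μ a} := by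
    ext I
    exact ⟨fun h => ⟨⟨⟨⟨h.1, h.2⟩, h.3⟩, h.4⟩, h.5⟩,
      fun h => ⟨h.1.1.1.1, h.1.1.1.2, h.1.1.2, h.1.2, h.2⟩⟩
  rw [heq]
  refine IsClosed.and (IsClosed.and (IsClosed.and (IsClosed.and ?_ ?_) ?_) ?_) ?_
  · simp only [Set.ofPred_forall]
    exact isClosed_iInter fun f => isClosed_iInter fun g => isClosed_eq (by fun_prop) (by fun_prop)
  · simp only [Set.ofPred_forall]
    exact isClosed_iInter fun c => isClosed_iInter fun f => isClosed_eq (by fun_prop) (by fun_prop)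
  · simp only [Set.ofPred_forall]
    exact isClosed_iInter fun f => isClosed_iInter fun _ => isClosed_le (by fun_prop) (by fun_prop)
  · simp only [Set.ofPred_forall]
    exact isClosed_iInter fun γ => isClosed_iInter fun f => isClosed_eq (by fun_prop) (by fun_prop)
  · simp only [Set.ofPred_forall]
    exact isClosed_iInter fun a => isClosed_eq (by fun_prop) (by fun_prop)

theorem integral_indicator_comp [MeasurableSpace W] [BorelSpace W] (ν : Measure W) (a : X.alg) :
    ∫ w, (X.alg.indicator a).comp q w ∂ν = ν.real (q ⁻¹' X.alg.basicClopen a) := by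
  have hm : MeasurableSet (q ⁻¹' X.alg.basicClopen a) :=
    ((X.alg.isClopen_basicClopen a).preimage q.continuous).2.measurableSet
  rw [← integral_indicator_one hm]
  rfl

/-- Normalized restriction to an invariant set preserves the marginal, by the uniqueness of the
invariant measure on an ergodic base. -/
theorem isInvariantLift_restrict [CompactSpace W] [MeasurableSpace W] [BorelSpace W]
    (hX : X.Ergodic) {ν : Measure W} [IsProbabilityMeasure ν]
    (hq : ∀ γ w, q (τ γ w) = Stone.map (X.T γ) (q w)) (hτ : ∀ γ, MeasurePreserving (τ γ) ν ν)
    (hν : ∀ a, ν.real (q ⁻¹' X.alg.basicClopen a) = X.alg.μ a) {A : Set W} (hA : MeasurableSet A)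
    (hinv : ∀ γ, τ γ ⁻¹' A =ᵐ[ν] A) (h0 : ν A ≠ 0) :
    IsInvariantLift X q τ fun f => (ν.real A)⁻¹ * ∫ w in A, f w ∂ν := by
  have hint : ∀ f : C(W, ℝ), Integrable f (ν.restrict A) := fun f =>
    f.continuous.integrable_of_hasCompactSupport (HasCompactSupport.of_compactSpace _)
  have hpos : 0 < ν.real A := ENNReal.toReal_pos h0 (measure_ne_top ν A)
  have hrestr : ∀ γ, MeasurePreserving (τ γ) (ν.restrict A) (ν.restrict A) := fun γ => by
    have h := (hτ γ).restrict_preimage hA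
    rwa [Measure.restrict_congr_set (hinv γ)] at h
  have hB : ∀ a, MeasurableSet (q ⁻¹' X.alg.basicClopen a) := fun a =>
    ((X.alg.isClopen_basicClopen a).preimage q.continuous).2.measurableSet
  refine ⟨fun f g => ?_, fun c f => ?_, fun f hf => ?_, fun γ f => ?_, fun a => ?_⟩
  · simp only [ContinuousMap.add_apply]
    rw [integral_add (hint f) (hint g), mul_add]
  · simp only [ContinuousMap.smul_apply, smul_eq_mul]
    rw [integral_const_mul]
    ring
  · exact mul_nonneg (inv_nonneg.mpr hpos.le) (integral_nonneg fun w => hf w)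
  · congr 1
    rw [← (hrestr γ).map_eq, integral_map (τ γ).continuous.aemeasurable
      f.continuous.aestronglyMeasurable, (hrestr γ).map_eq]
    rfl
  · rw [integral_indicator_comp]
    refine hX.eq_μ (m := fun a => (ν.real A)⁻¹ * (ν.restrict A).real (q ⁻¹' X.alg.basicClopen a))
      (C := (ν.real A)⁻¹) ?_ ?_ ?_ ?_ ?_ a
    · intro a b hab
      rw [X.alg.basicClopen_sup, Set.preimage_union, measureReal_union _ (hB b), mul_add]
      refine Disjoint.preimage q (Set.disjoint_iff_inter_eq_empty.mpr ?_)
      rw [← X.alg.basicClopen_inf, hab.eq_bot, X.alg.basicClopen_bot]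
    · intro a
      positivity
    · intro a
      refine mul_le_mul_of_nonneg_left ?_ (inv_nonneg.mpr hpos.le)
      rw [← hν a]
      exact ENNReal.toReal_mono (measure_ne_top _ _) (Measure.restrict_apply_le _ _)
    · intro γ a
      have : q ⁻¹' X.alg.basicClopen ((X.T γ).pullback a) =
          τ γ ⁻¹' (q ⁻¹' X.alg.basicClopen a) := by
        ext w
        simp [hq]
      rw [this, (hrestr γ).measureReal_preimage (hB a).nullMeasurableSet]
    · rw [X.alg.basicClopen_top, Set.preimage_univ, measureReal_restrict_apply_univ,
        inv_mul_cancel₀ hpos.ne']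

/-- Over an ergodic system, the existence of an invariant lift implies that of an ergodic one: an
extreme point of the compact convex set of invariant lifts. -/
theorem exists_ergodic_measure [CompactSpace W] [T2Space W] [MeasurableSpace W] [BorelSpace W]
    (hX : X.Ergodic) (hq : ∀ γ w, q (τ γ w) = Stone.map (X.T γ) (q w))
    (hone : ∀ w, τ 1 w = w) (hmul : ∀ γ γ' w, τ (γ * γ') w = τ γ (τ γ' w))
    (hne : ∃ I, IsInvariantLift X q τ I) :
    ∃ ν : Measure W, ν.Regular ∧ IsProbabilityMeasure ν ∧ (∀ γ, MeasurePreserving (τ γ) ν ν) ∧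
      (∀ a, ν.real (q ⁻¹' X.alg.basicClopen a) = X.alg.μ a) ∧
      ∀ A, MeasurableSet A → (∀ γ, τ γ ⁻¹' A =ᵐ[ν] A) → ν A = 0 ∨ ν Aᶜ = 0 := by
  obtain ⟨I, hIe⟩ := (isCompact_isInvariantLift (X := X) (q := q) (τ := τ)).extremePoints_nonempty
    hne
  rw [mem_extremePoints] at hIe
  obtain ⟨hI, hext⟩ := hIe
  replace hI : IsInvariantLift X q τ I := hI
  obtain ⟨ν, hreg, hfin, hν⟩ :=
    exists_regular_measure_of_positive I hI.map_add hI.map_smul hI.nonneg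
  have hmarg : ∀ a, ν.real (q ⁻¹' X.alg.basicClopen a) = X.alg.μ a := fun a => by
    rw [← integral_indicator_comp, hν, hI.marginal]
  have hprob : IsProbabilityMeasure ν := by
    have h := hmarg ⊤
    rw [X.alg.basicClopen_top, Set.preimage_univ, X.alg.μ_top] at h
    exact ⟨(ENNReal.toReal_eq_one_iff _).mp h⟩
  have hpres : ∀ γ, MeasurePreserving (τ γ) ν ν := by
    intro γ
    refine ⟨(τ γ).continuous.measurable, ?_⟩
    let e : W ≃ₜ W :=
      { toFun := τ γ
        invFun := τ γ⁻¹
        left_inv := fun w => by rw [← hmul, inv_mul_cancel, hone]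
        right_inv := fun w => by rw [← hmul, mul_inv_cancel, hone]
        continuous_toFun := (τ γ).continuous
        continuous_invFun := (τ γ⁻¹).continuous }
    have : (ν.map (τ γ)).Regular := Measure.Regular.map e
    refine measure_eq_of_integral_continuousMap_eq fun f => ?_
    rw [integral_map (τ γ).continuous.aemeasurable f.continuous.aestronglyMeasurable, hν,
      ← hI.invariant γ, ← hν]
    rfl
  refine ⟨ν, hreg, hprob, hpres, hmarg, fun A hA hinv => ?_⟩
  by_contra! hcon
  obtain ⟨h0, h1⟩ := hcon
  have hpos : 0 < ν.real A := ENNReal.toReal_pos h0 (measure_ne_top ν A)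
  have hpos' : 0 < ν.real Aᶜ := ENNReal.toReal_pos h1 (measure_ne_top ν Aᶜ)
  have hI₁ := isInvariantLift_restrict hX hq hpres hmarg hA hinv h0
  have hI₂ := isInvariantLift_restrict hX hq hpres hmarg hA.compl (fun γ => (hinv γ).compl) h1
  have hseg : I ∈ openSegment ℝ (fun f : C(W, ℝ) => (ν.real A)⁻¹ * ∫ w in A, f w ∂ν)
      (fun f : C(W, ℝ) => (ν.real Aᶜ)⁻¹ * ∫ w in Aᶜ, f w ∂ν) := by
    refine ⟨ν.real A, ν.real Aᶜ, hpos, hpos', ?_, funext fun f => ?_⟩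
    · rw [probReal_add_probReal_compl hA]
    · simp only [Pi.add_apply, Pi.smul_apply, smul_eq_mul]
      rw [mul_inv_cancel_left₀ hpos.ne', mul_inv_cancel_left₀ hpos'.ne', ← hν]
      exact integral_add_compl hA
        (f.continuous.integrable_of_hasCompactSupport (HasCompactSupport.of_compactSpace _))
  -- Extremality makes the restriction of `ν` to `A` proportional to `ν`, although it vanishes on
  -- the complement of `A`.
  have heq := (hext _ hI₁ _ hI₂ hseg).1
  have hregA : (ν.restrict A).Regular := Measure.Regular.restrict_of_measure_ne_top
    (measure_ne_top ν A)
  have hregs : (ν A • ν).Regular := Measure.Regular.smul (measure_ne_top ν A)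
  have hmeas : ν.restrict A = ν A • ν := by
    refine measure_eq_of_integral_continuousMap_eq fun f => ?_
    have hf := congrFun heq f
    rw [integral_smul_measure, hν, ← hf]
    change _ = ν.real A • _
    rw [smul_eq_mul, mul_inv_cancel_left₀ hpos.ne']
  have hcompl := congrArg (fun m : Measure W => m Aᶜ) hmeas
  simp only [Measure.smul_apply, smul_eq_mul] at hcompl
  rw [Measure.restrict_apply hA.compl, Set.compl_inter_self, measure_empty] at hcompl
  exact mul_ne_zero h0 h1 hcompl.symm

end ErgodicLift

/-! ### Invariant lifts obtained by averaging over the fibres -/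

section Lift

open MeasureTheory Filter

/-- The σ-algebra generated by the basic clopen sets, for which the measure of `X` extends by
Carathéodory's theorem; continuous functions are measurable for it. -/
instance (X : ProbAlg.{uX}) : MeasurableSpace (Stone X) :=
  MeasurableSpace.generateFrom (Set.range X.basicClopen)

theorem ProbAlg.isSetRing_basicClopen (X : ProbAlg.{uX}) :
    IsSetRing (Set.range X.basicClopen) where
  empty_mem := ⟨⊥, X.basicClopen_bot⟩
  union_mem := by
    rintro _ _ ⟨a, rfl⟩ ⟨b, rfl⟩
    exact ⟨a ⊔ b, X.basicClopen_sup a b⟩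
  sdiff_mem := by
    rintro _ _ ⟨a, rfl⟩ ⟨b, rfl⟩
    exact ⟨a \ b, X.basicClopen_sdiff a b⟩

theorem ProbAlg.measurableSet_basicClopen (X : ProbAlg.{uX}) (a : X) :
    MeasurableSet (X.basicClopen a) :=
  MeasurableSpace.measurableSet_generateFrom ⟨a, rfl⟩

/-- The measure of `X` extends to a measure on the Stone space: by compactness, it is continuous
at the empty set on the ring of basic clopen sets. -/
theorem ProbAlg.exists_stone_measure (X : ProbAlg.{uX}) :
    ∃ P : Measure (Stone X), ∀ a, P (X.basicClopen a) = ENNReal.ofReal (X.μ a) := by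
  have : Nonempty X := ⟨⊥⟩
  -- A basic clopen set determines its element; the value of `m` on other sets is irrelevant.
  let m : Set (Stone X) → ENNReal := fun A =>
    ENNReal.ofReal (X.μ (Function.invFun X.basicClopen A))
  have hm : ∀ a, m (X.basicClopen a) = ENNReal.ofReal (X.μ a) := fun a => by
    simp only [m, Function.leftInverse_invFun X.basicClopen_injective a]
  have hempty : m ∅ = 0 := by rw [← X.basicClopen_bot, hm, X.μ_bot, ENNReal.ofReal_zero]
  let c : AddContent ENNReal (Set.range X.basicClopen) :=
    X.isSetRing_basicClopen.addContent_of_union m hempty (by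
      rintro _ _ ⟨a, rfl⟩ ⟨b, rfl⟩ hd
      have hab : Disjoint a b := by
        rw [disjoint_iff]
        apply X.basicClopen_injective
        rw [X.basicClopen_inf, X.basicClopen_bot]
        exact hd.inter_eq
      rw [← X.basicClopen_sup, hm, hm, hm, X.μ_sup hab,
        ENNReal.ofReal_add (X.μ_nonneg a) (X.μ_nonneg b)])
  have hc : ∀ a, c (X.basicClopen a) = ENNReal.ofReal (X.μ a) := hm
  have hsub : c.IsSigmaSubadditive := by
    refine isSigmaSubadditive_of_addContent_iUnion_eq_tsum X.isSetRing_basicClopen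
      fun f hf hU hd => addContent_iUnion_eq_sum_of_tendsto_zero X.isSetRing_basicClopen c ?_ ?_
        hf hU hd
    · rintro _ ⟨a, rfl⟩
      rw [hc]
      exact ENNReal.ofReal_ne_top
    · intro s hs hanti hinter
      have hcl : ∀ n, IsClosed (s n) := fun n => by
        obtain ⟨a, ha⟩ := hs n
        rw [← ha]
        exact (X.isClopen_basicClopen a).1
      have hex : ∃ n, s n = ∅ := by
        by_contra! hne
        have h := IsCompact.nonempty_iInter_of_sequence_nonempty_isCompact_isClosed s
          (fun n => hanti n.le_succ) hne (hcl 0).isCompact hcl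
        rw [hinter] at h
        exact Set.not_nonempty_empty h
      obtain ⟨n, hn⟩ := hex
      refine tendsto_atTop_of_eventually_const (i₀ := n) fun k hk => ?_
      have : s k = ∅ := Set.subset_empty_iff.mp (hn ▸ hanti hk)
      rw [this, addContent_empty]
  refine ⟨c.measure X.isSetRing_basicClopen.isSetSemiring le_rfl hsub, fun a => ?_⟩
  rw [AddContent.measure_eq c X.isSetRing_basicClopen.isSetSemiring rfl hsub ⟨a, rfl⟩, hc]

theorem Stone.measurable_continuousMap {X : ProbAlg.{uX}} (f : C(Stone X, ℝ)) : Measurable f := by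
  refine measurable_continuousMap_of_separates _ (fun s t hst => ?_) f
  have hne : ∃ a, s a ≠ t a := by
    by_contra! h
    exact hst (Stone.ext_iff.mpr h)
  obtain ⟨a, ha⟩ := hne
  refine ⟨X.indicator a, measurable_one.indicator (X.measurableSet_basicClopen a), ?_⟩
  simp only [ProbAlg.indicator, ContinuousMap.coe_mk, Set.indicator, ProbAlg.mem_basicClopen]
  cases hs : s a <;> cases ht : t a <;> simp_all

theorem Stone.measurePreserving_map {X : ProbAlg.{uX}} {P : Measure (Stone X)} [IsFiniteMeasure P]
    (hP : ∀ a, P (X.basicClopen a) = ENNReal.ofReal (X.μ a)) (T : ProbAlg.Hom X X) :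
    MeasurePreserving (Stone.map T) P P := by
  have hpre : ∀ a, Stone.map T ⁻¹' X.basicClopen a = X.basicClopen (T.pullback a) := fun _ => rfl
  have hm : Measurable (Stone.map T) := by
    refine measurable_generateFrom ?_
    rintro _ ⟨a, rfl⟩
    exact X.measurableSet_basicClopen _
  have hset : ∀ a, (P.map (Stone.map T)) (X.basicClopen a) = P (X.basicClopen a) := fun a => by
    rw [Measure.map_apply hm (X.measurableSet_basicClopen a), hpre, hP, hP, T.μ_pullback]
  refine ⟨hm, ext_of_generate_finite _ rfl X.isSetRing_basicClopen.isSetSemiring.isPiSystem ?_ ?_⟩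
  · rintro _ ⟨a, rfl⟩
    exact hset a
  · rw [← X.basicClopen_top]
    exact hset ⊤

theorem continuous_integral_continuousMap {L : Type uK} [TopologicalSpace L] [CompactSpace L]
    [MeasurableSpace L] [BorelSpace L] (h : Measure L) [IsProbabilityMeasure h] :
    Continuous fun g : C(L, ℝ) => ∫ l, g l ∂h := by
  have hint : ∀ g : C(L, ℝ), Integrable g h := fun g =>
    g.continuous.integrable_of_hasCompactSupport (HasCompactSupport.of_compactSpace _)
  refine (LipschitzWith.of_dist_le_mul (K := 1) fun g g' => ?_).continuous
  rw [Real.dist_eq, ← integral_sub (hint g) (hint g'), dist_eq_norm, NNReal.coe_one, one_mul]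
  have := norm_integral_le_of_norm_le_const (μ := h) (f := fun l => g l - g' l) (C := ‖g - g'‖)
    (Eventually.of_forall fun l => (g - g').norm_coe_le_norm l)
  simpa using this

/-- Averaging over the fibres of `q` an invariant measure on the Stone space gives an invariant
lift, when the fibres are the orbits of a right action `σ` of a compact group that commutes with
the maps `τ γ`. -/
theorem exists_isInvariantLift {Γ : Type uG} [Group Γ] (X : System.{uX} Γ) {W : Type uW}
    [TopologicalSpace W] [CompactSpace W] (q : C(W, Stone X.alg)) (τ : Γ → C(W, W))
    (hq : ∀ γ w, q (τ γ w) = Stone.map (X.T γ) (q w)) (hsurj : Function.Surjective q)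
    {L : Type uK} [Group L] [TopologicalSpace L] [IsTopologicalGroup L] [CompactSpace L]
    (σ : L → W → W) (hσ : Continuous fun p : W × L => σ p.2 p.1)
    (hmul : ∀ l l' w, σ l' (σ l w) = σ (l * l') w) (hqσ : ∀ l w, q (σ l w) = q w)
    (htrans : ∀ w w', q w = q w' → ∃ l, w' = σ l w)
    (hcomm : ∀ γ l w, τ γ (σ l w) = σ l (τ γ w)) :
    ∃ I, IsInvariantLift X q τ I := by
  let : MeasurableSpace L := borel L
  have : BorelSpace L := ⟨rfl⟩
  let h : Measure L := Measure.haarMeasure ⊤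
  have : IsProbabilityMeasure h := ⟨Measure.haarMeasure_self (K₀ := ⊤)⟩
  obtain ⟨P, hP⟩ := X.alg.exists_stone_measure
  have : IsProbabilityMeasure P := ⟨by
    rw [← X.alg.basicClopen_top, hP, X.alg.μ_top, ENNReal.ofReal_one]⟩
  have hσw : ∀ w, Continuous fun l => σ l w := fun w =>
    hσ.comp (continuous_const.prodMk continuous_id)
  have hint : ∀ (f : C(W, ℝ)) w, Integrable (fun l => f (σ l w)) h := fun f w =>
    (f.continuous.comp (hσw w)).integrable_of_hasCompactSupport
      (HasCompactSupport.of_compactSpace _)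
  let avg : C(W, ℝ) → W → ℝ := fun f w => ∫ l, f (σ l w) ∂h
  have havg_cont : ∀ f, Continuous (avg f) := fun f =>
    (continuous_integral_continuousMap h).comp
      (ContinuousMap.curry (⟨fun p : W × L => f (σ p.2 p.1), f.continuous.comp hσ⟩ :
        C(W × L, ℝ))).continuous
  have havg_inv : ∀ f w w', q w = q w' → avg f w = avg f w' := by
    intro f w w' hww
    obtain ⟨l₀, rfl⟩ := htrans w w' hww
    simp only [avg, hmul]
    exact (integral_mul_left_eq_self (fun l => f (σ l w)) l₀).symm
  have hquot : Topology.IsQuotientMap q :=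
    q.continuous.isClosedMap.isQuotientMap q.continuous hsurj
  -- The average is constant on the fibres, so it descends to the Stone space, continuously because
  -- `q` is a quotient map. The section `sec` need not be continuous.
  choose sec hsec using hsurj
  have hdesc : ∀ f w, avg f (sec (q w)) = avg f w := fun f w => havg_inv f _ _ (hsec _)
  let F : C(W, ℝ) → C(Stone X.alg, ℝ) := fun f =>
    ⟨fun s => avg f (sec s), hquot.continuous_iff.mpr ((havg_cont f).congr fun w =>
      (hdesc f w).symm)⟩
  have hF : ∀ f w, F f (q w) = ∫ l, f (σ l w) ∂h := hdesc
  have hext : ∀ G G' : C(Stone X.alg, ℝ), (∀ w, G (q w) = G' (q w)) → G = G' := by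
    intro G G' hG
    ext s
    rw [← hsec s]
    exact hG _
  have hintP : ∀ G : C(Stone X.alg, ℝ), Integrable G P := fun G =>
    Integrable.of_bound (Stone.measurable_continuousMap G).aestronglyMeasurable ‖G‖
      (Eventually.of_forall G.norm_coe_le_norm)
  refine ⟨fun f => ∫ s, F f s ∂P, fun f g => ?_, fun c f => ?_, fun f hf => ?_, fun γ f => ?_,
    fun a => ?_⟩
  · have : F (f + g) = F f + F g := hext _ _ fun w => by
      rw [ContinuousMap.add_apply, hF, hF, hF]
      exact integral_add (hint f w) (hint g w)
    rw [this]
    exact integral_add (hintP _) (hintP _)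
  · have : F (c • f) = c • F f := hext _ _ fun w => by
      rw [ContinuousMap.smul_apply, hF, hF]
      exact integral_smul c _
    rw [this]
    exact integral_smul c _
  · exact integral_nonneg fun s => integral_nonneg fun l => hf _
  · have hT := Stone.measurePreserving_map hP (X.T γ)
    have : F (f.comp (τ γ)) = (F f).comp ⟨_, Stone.continuous_map (X.T γ)⟩ := hext _ _ fun w => by
      change _ = F f (Stone.map (X.T γ) (q w))
      rw [← hq, hF, hF]
      simp only [ContinuousMap.comp_apply, hcomm]
    rw [this]
    simp only [ContinuousMap.comp_apply, ContinuousMap.coe_mk]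
    rw [← integral_map hT.measurable.aemeasurable
      (Stone.measurable_continuousMap (F f)).aestronglyMeasurable, hT.map_eq]
  · have : F ((X.alg.indicator a).comp q) = X.alg.indicator a := hext _ _ fun w => by
      rw [hF]
      simp [hqσ]
    rw [this]
    refine (integral_indicator_one (X.alg.measurableSet_basicClopen a)).trans ?_
    rw [measureReal_def, hP, ENNReal.toReal_ofReal (X.alg.μ_nonneg a)]

end Lift

/-! ### The fibre product of the extension with the compact group -/

open MeasureTheory in
theorem BaireSet.measurableSet_preimage {W : Type uW} {Z : Type uZ} [TopologicalSpace W]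
    [MeasurableSpace W] [BorelSpace W] [TopologicalSpace Z] (g : C(W, Z)) (E : BaireSet Z) :
    MeasurableSet (g ⁻¹' E.1) := by
  have hle : baire W ≤ ‹MeasurableSpace W› := iSup_le fun f => by
    rw [BorelSpace.measurable_eq (α := W)]
    exact f.continuous.borel_measurable.comap_le
  exact hle _ (measurable_baire_of_continuous g E.2)

theorem t2Space_quotient_of_isClosed {K : Type uK} [Group K] [TopologicalSpace K]
    [IsTopologicalGroup K] {L : Subgroup K} (hL : IsClosed (L : Set K)) : T2Space (K ⧸ L) := by
  rw [t2Space_iff_of_isOpenQuotientMap (QuotientGroup.isOpenQuotientMap_mk (N := L))]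
  have : {p : K × K | (p.1 : K ⧸ L) = (p.2 : K ⧸ L)} = (fun p : K × K => p.1⁻¹ * p.2) ⁻¹' L := by
    ext p
    exact QuotientGroup.eq
  change IsClosed {p : K × K | (p.1 : K ⧸ L) = (p.2 : K ⧸ L)}
  rw [this]
  exact hL.preimage (by fun_prop)

section Extension

variable {Γ : Type uG} [Group Γ] {Y : System.{uY} Γ} {K : Type uK} [Group K] [TopologicalSpace K]
  [CompactSpace K] {Z : Type uZ} [TopologicalSpace Z] [CompactSpace Z] [MulAction K Z]
  (X : Extension.{uX} Y K Z)

theorem Extension.map_π_map_T (γ : Γ) (s : Stone X.sys.alg) :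
    Stone.map X.π.toHom (Stone.map (X.sys.T γ) s) = Stone.map (Y.T γ) (Stone.map X.π.toHom s) :=
  congrArg (fun T => Stone.map T s) (X.π.equivariant γ)

theorem Extension.rep_θ_map_T [T2Space K] [T2Space Z] (γ : Γ) (s : Stone X.sys.alg) :
    X.θ.rep (Stone.map (X.sys.T γ) s) = (X.ρ γ).rep (Stone.map X.π.toHom s) • X.θ.rep s := by
  rw [← Cond.rep_comp, X.equivariant γ s, Cond.rep_comp]

theorem Extension.rep_ρ_mul [T2Space K] (γ γ' : Γ) (t : Stone Y.alg) :
    (X.ρ (γ * γ')).rep t = (X.ρ γ).rep (Stone.map (Y.T γ') t) * (X.ρ γ').rep t := by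
  rw [X.cocycle γ γ' t, Cond.rep_comp, smul_eq_mul]

end Extension

section FibreProduct

variable {Γ : Type uG} [Group Γ] {Y : System.{uY} Γ} {K : Type uK} [Group K] [TopologicalSpace K]
  [IsTopologicalGroup K] [CompactSpace K] {L : Subgroup K}

/-- The pairs of a point `s` of the Stone space of `X` and an element `k` of `K` in the coset given
by the vertical coordinate at `s`. -/
abbrev FibreProduct (X : HomogeneousExtension.{uX} Y K L) : Type (max uX uK) :=
  {p : Stone X.sys.alg × K // X.θ.rep p.1 = (p.2 : K ⧸ L)}

variable (X : HomogeneousExtension.{uX} Y K L)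

/-- The projection of the fibre product to the Stone space. -/
def FibreProduct.base : C(FibreProduct X, Stone X.sys.alg) :=
  ⟨fun w => w.1.1, by fun_prop⟩

/-- The projection of the fibre product to the group. -/
def FibreProduct.vertical : C(FibreProduct X, K) :=
  ⟨fun w => w.1.2, by fun_prop⟩

theorem FibreProduct.compactSpace [T2Space (K ⧸ L)] : CompactSpace (FibreProduct X) := by
  have : IsClosed {p : Stone X.sys.alg × K | X.θ.rep p.1 = (p.2 : K ⧸ L)} :=
    isClosed_eq (X.θ.continuous_rep.comp continuous_fst)
      (QuotientGroup.continuous_mk.comp continuous_snd)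
  exact isCompact_iff_compactSpace.mp this.isCompact

theorem FibreProduct.base_surjective : Function.Surjective (FibreProduct.base X) := by
  intro s
  obtain ⟨k, hk⟩ := QuotientGroup.mk_surjective (X.θ.rep s)
  exact ⟨⟨(s, k), hk.symm⟩, rfl⟩

/-- The action of the acting group on the fibre product, through the cocycle on the second
coordinate. -/
noncomputable def FibreProduct.act [T2Space K] [T2Space (K ⧸ L)] (γ : Γ) :
    C(FibreProduct X, FibreProduct X) where
  toFun w := ⟨(Stone.map (X.sys.T γ) w.1.1, (X.ρ γ).rep (Stone.map X.π.toHom w.1.1) * w.1.2), by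
    change X.θ.rep (Stone.map (X.sys.T γ) w.1.1) = _
    rw [X.rep_θ_map_T, w.2]
    rfl⟩
  continuous_toFun := by
    have h1 : Continuous fun w : FibreProduct X => w.1.1 := by fun_prop
    have h2 : Continuous fun w : FibreProduct X => w.1.2 := by fun_prop
    exact (((Stone.continuous_map _).comp h1).prodMk
      ((((X.ρ γ).continuous_rep.comp (Stone.continuous_map _)).comp h1).mul h2)).subtype_mk _

theorem FibreProduct.act_one [T2Space K] [T2Space (K ⧸ L)] (w : FibreProduct X) :
    FibreProduct.act X 1 w = w := by
  -- The cocycle identity at `(1, 1)` gives `ρ 1 = 1`.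
  have h := X.rep_ρ_mul 1 1 (Stone.map X.π.toHom w.1.1)
  rw [one_mul, Y.T_one, Stone.map_id, left_eq_mul] at h
  refine Subtype.ext (Prod.ext ?_ ?_)
  · change Stone.map (X.sys.T 1) w.1.1 = w.1.1
    rw [X.sys.T_one, Stone.map_id]
  · change (X.ρ 1).rep (Stone.map X.π.toHom w.1.1) * w.1.2 = w.1.2
    rw [h, one_mul]

theorem FibreProduct.act_mul [T2Space K] [T2Space (K ⧸ L)] (γ γ' : Γ) (w : FibreProduct X) :
    FibreProduct.act X (γ * γ') w = FibreProduct.act X γ (FibreProduct.act X γ' w) := by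
  refine Subtype.ext (Prod.ext ?_ ?_)
  · change Stone.map (X.sys.T (γ * γ')) w.1.1 = _
    rw [X.sys.T_mul, Stone.map_comp]
    rfl
  · change (X.ρ (γ * γ')).rep (Stone.map X.π.toHom w.1.1) * w.1.2 =
      (X.ρ γ).rep (Stone.map X.π.toHom (Stone.map (X.sys.T γ') w.1.1)) *
        ((X.ρ γ').rep (Stone.map X.π.toHom w.1.1) * w.1.2)
    rw [X.rep_ρ_mul, X.map_π_map_T, mul_assoc]

/-- The fibres of the fibre product over the Stone space are the orbits of right translation by
`L`, which commutes with the action of the acting group. -/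
theorem FibreProduct.exists_isInvariantLift [T2Space K] [T2Space (K ⧸ L)]
    (hL : IsClosed (L : Set K)) :
    ∃ I, IsInvariantLift X.sys (FibreProduct.base X) (FibreProduct.act X) I := by
  have : CompactSpace (FibreProduct X) := FibreProduct.compactSpace X
  have : CompactSpace L := isCompact_iff_compactSpace.mp hL.isCompact
  refine AbstractErgodic.exists_isInvariantLift X.sys _ _ (fun _ _ => rfl)
    (FibreProduct.base_surjective X)
    (fun (l : L) w => ⟨(w.1.1, w.1.2 * l), w.2.trans (QuotientGroup.mk_mul_of_mem w.1.2 l.2).symm⟩)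
    ?_ ?_ (fun _ _ => rfl) ?_ ?_
  · refine Continuous.subtype_mk ?_ _
    fun_prop
  · exact fun l l' w => Subtype.ext (Prod.ext rfl (mul_assoc _ _ _))
  · rintro ⟨⟨s, k⟩, hk⟩ ⟨⟨s', k'⟩, hk'⟩ hs
    obtain rfl : s = s' := hs
    refine ⟨⟨k⁻¹ * k', QuotientGroup.eq.mp (hk.symm.trans hk')⟩, Subtype.ext (Prod.ext rfl ?_)⟩
    exact (mul_inv_cancel_left k k').symm
  · exact fun γ l w => Subtype.ext (Prod.ext rfl (mul_assoc _ _ _).symm)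

end FibreProduct

end AbstractErgodic

open AbstractErgodic

open MeasureTheory MeasureAlgebra in
theorem theorem6p1 (Γ : Type uG) [Group Γ] (Y : System.{uY} Γ) (hY : Y.Ergodic)
    (K : Type uK) [Group K] [TopologicalSpace K] [IsTopologicalGroup K] [CompactSpace K] [T2Space K]
    (L : Subgroup K) (hL : IsClosed (L : Set K))
    (X : HomogeneousExtension.{uX} Y K L) (hX : X.sys.Ergodic) :
    ∃ (X' : CompactGroupExtension.{max uX uK} Y K) (p : System.Hom X'.sys X.sys),
      X'.π.toHom = X.π.toHom.comp p.toHom ∧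
      X'.θ.map (projQuotient K L) = X.θ.comp p.toHom ∧
      X'.sys.Ergodic := by
  have : T2Space (K ⧸ L) := t2Space_quotient_of_isClosed hL
  have : CompactSpace (FibreProduct X) := FibreProduct.compactSpace X
  let _ : MeasurableSpace (FibreProduct X) := borel _
  have : BorelSpace (FibreProduct X) := ⟨rfl⟩
  obtain ⟨ν, hreg, hprob, hpres, hmarg, herg⟩ := exists_ergodic_measure hX (fun _ _ => rfl)
    (FibreProduct.act_one X) (FibreProduct.act_mul X) (FibreProduct.exists_isInvariantLift X hL)
  have hB : ∀ a, MeasurableSet (FibreProduct.base X ⁻¹' X.sys.alg.basicClopen a) := fun a =>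
    ((X.sys.alg.isClopen_basicClopen a).preimage (FibreProduct.base X).continuous).2.measurableSet
  let sys : System.{max uX uK} Γ :=
    { alg := measureProbAlg ν
      T := fun γ => homOfMap (FibreProduct.act X γ) (hpres γ)
      T_one := ProbAlg.Hom.ext (DFunLike.ext _ _ (MeasureAlgebra.ind fun A hA => mk_congr (by
        ext w
        rw [Set.mem_preimage, FibreProduct.act_one])))
      T_mul := fun γ γ' => ProbAlg.Hom.ext (DFunLike.ext _ _ (MeasureAlgebra.ind fun A hA =>
        mk_congr (by
          ext w
          rw [Set.mem_preimage, FibreProduct.act_mul]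
          rfl))) }
  let p : System.Hom sys X.sys :=
    { toHom := homOfSets (fun a => FibreProduct.base X ⁻¹' X.sys.alg.basicClopen a) hB
        (fun a b => by rw [ProbAlg.basicClopen_sup, Set.preimage_union])
        (fun a b => by rw [ProbAlg.basicClopen_inf, Set.preimage_inter])
        (by rw [ProbAlg.basicClopen_top, Set.preimage_univ])
        (by rw [ProbAlg.basicClopen_bot, Set.preimage_empty]) hmarg
      equivariant := fun γ => ProbAlg.Hom.ext (DFunLike.ext _ _ fun a => mk_congr rfl) }
  let θ : Cond sys.alg K := condOfMap (FibreProduct.vertical X)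
    (BaireSet.measurableSet_preimage (FibreProduct.vertical X))
  have hθ : θ.map (projQuotient K L) = X.θ.comp p.toHom := by
    refine Cond.ext_of_closed_le_open fun E F hE _ hFE => mk_mono fun w hw => ?_
    refine X.θ.rep_spec w.1.1 E (hE.mem_nhds (hFE ?_))
    rw [w.2]
    exact hw
  let X' : CompactGroupExtension.{max uX uK} Y K :=
    { sys := sys
      π := ⟨X.π.toHom.comp p.toHom, fun γ => by
        have h1 : (X.π.toHom.comp p.toHom).comp (sys.T γ) =
          X.π.toHom.comp (p.toHom.comp (sys.T γ)) := rfl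
        have h2 : X.π.toHom.comp ((X.sys.T γ).comp p.toHom) =
          (X.π.toHom.comp (X.sys.T γ)).comp p.toHom := rfl
        rw [h1, p.equivariant γ, h2, X.π.equivariant γ]
        rfl⟩
      θ := θ
      ρ := X.ρ
      cocycle := X.cocycle
      equivariant := fun γ => by
        refine Cond.isSMul_of_inf_eq_bot fun E F G hE hEFG => mk_congr ?_
        refine Set.eq_empty_of_forall_notMem ?_
        rintro w ⟨⟨hwE, hwF⟩, hwG⟩
        exact hEFG _ ((X.ρ γ).rep_mem (Stone.map X.π.toHom w.1.1) E hE hwE) _ hwF hwG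
      generates := by
        intro S hG hbot hcompl hlub
        -- `S` contains the image of `X`, by the generation property of `X`.
        have hpS : ∀ a, p.toHom.pullback a ∈ S := by
          refine X.generates {a | p.toHom.pullback a ∈ S} ?_ ?_ ?_ ?_
          · rintro _ (⟨y, rfl⟩ | ⟨E, rfl⟩)
            · exact hG (Or.inl ⟨y, rfl⟩)
            · refine hG (Or.inr ⟨BaireSet.preimage (projQuotient K L) E, ?_⟩)
              exact congrArg (fun c => Cond.pullback c E) hθ
          · rw [Set.mem_ofPred_eq, map_bot]
            exact hbot
          · intro a ha
            rw [Set.mem_ofPred_eq, map_compl']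
            exact hcompl _ ha
          · exact fun f hf a ha => hlub _ hf _ (p.toHom.pullback_isLUB f a ha)
        refine mem_of_separates hbot hcompl hlub fun w w' hne => ?_
        by_cases hs : w.1.1 = w'.1.1
        · have hk : w.1.2 ≠ w'.1.2 := fun hk => hne (Subtype.ext (Prod.ext hs hk))
          obtain ⟨f, hf0, hf1, -⟩ := exists_continuous_zero_one_of_isClosed
            (isClosed_singleton (x := w.1.2)) (isClosed_singleton (x := w'.1.2)) (by simpa using hk)
          refine ⟨f.comp (FibreProduct.vertical X), ?_, fun V hV => ?_⟩
          · have h0 : f w.1.2 = 0 := hf0 rfl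
            have h1 : f w'.1.2 = 1 := hf1 rfl
            change f w.1.2 ≠ f w'.1.2
            rw [h0, h1]
            exact zero_ne_one
          · let g : C(K, ℂ) := ⟨fun k => (f k : ℂ), by fun_prop⟩
            exact hG (Or.inr ⟨⟨g ⁻¹' (Complex.re ⁻¹' V), measurableSet_baire_preimage g
              (Complex.measurable_re hV.measurableSet)⟩, rfl⟩)
        · have hex : ∃ a, w.1.1 a ≠ w'.1.1 a := by
            by_contra! h
            exact hs (Stone.ext_iff.mpr h)
          obtain ⟨a, ha⟩ := hex
          refine ⟨(X.sys.alg.indicator a).comp (FibreProduct.base X), ?_, fun V hV => ?_⟩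
          · change (X.sys.alg.basicClopen a).indicator 1 w.1.1 ≠
              (X.sys.alg.basicClopen a).indicator 1 w'.1.1
            simp only [Set.indicator, ProbAlg.mem_basicClopen]
            cases h1 : w.1.1 a <;> cases h2 : w'.1.1 a <;> simp_all
            -- Preimages under an indicator function are basic clopen sets.
          · have hV' : ∃ b, X.sys.alg.indicator a ⁻¹' V = X.sys.alg.basicClopen b := by
              have := Set.indicator_const_preimage (X.sys.alg.basicClopen a) V (1 : ℝ)
              rcases this with h | h | h | h
              · exact ⟨⊤, h.trans (ProbAlg.basicClopen_top _).symm⟩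
              · exact ⟨a, h⟩
              · exact ⟨aᶜ, h.trans (ProbAlg.basicClopen_compl _ a).symm⟩
              · exact ⟨⊥, h.trans (ProbAlg.basicClopen_bot _).symm⟩
            obtain ⟨b, hb⟩ := hV'
            exact Set.mem_of_eq_of_mem (mk_congr (congrArg (FibreProduct.base X ⁻¹' ·) hb))
              (hpS b) }
  refine ⟨X', p, rfl, hθ, MeasureAlgebra.ind fun A hA hinv => ?_⟩
  rcases herg A hA fun γ => mk_eq_mk.mp (hinv γ) with h | h
  · exact Or.inl (mk_eq_mk.mpr (ae_eq_empty.mpr h))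
  · exact Or.inr (mk_eq_mk.mpr (ae_eq_univ.mpr h))
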